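/- **Lemma (Strip Unfolding).** Let $n_x,n_y$ be positive integers and let $C$ be a lattice quadrilateral convex cap over the rectangle $B=[1,n_x]\times[1,n_y]$: the graph $\{(x,y,z(x,y))\}$ of a concave function $z:B\to\mathbb R$ whose restriction to each unit lattice cell $[i,i+1]\times[j,j+1]\subseteq B$ is affine. The part of $C$ above a lattice cell is called a quadrilateral. An $x$-strip consists of the quadrilaterals above $[1,n_x]\times[y,y+1]$ for an integer $1\le y<n_y$; its lower and upper boundary chains have the vertices $p_i=(i,y,z(i,y))$ and $q_i=(i,y+1,z(i,y+1))$, $1\le i\le n$, where $n=n_x$. The $y$-strips are defined likewise with the roles of the coordinates interchanged (with $n=n_y$). The segments $p_iq_i$ are the ladder edges of the strip. An unfolding of a strip is a map $\varphi$ of its surface to the Euclidean plane which is isometric on each quadrilateral and places any two consecutive quadrilaterals on opposite sides of the line through their common ladder edge. Then every ($x$- or $y$-) strip of $C$ has an unfolding, and for every unfolding $\varphi$ of the strip the following hold. Write $u_i=\varphi(p_i)$, $w_i=\varphi(q_i)$. The (signed) turn angle of a planar chain at an interior vertex is the angle in $(-\pi,\pi]$ from the direction of the incoming edge to that of the outgoing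 edge. 1. The strip does not overlap itself: $\varphi$ is injective on the surface of the strip. 2. The polygonal boundary curves $u=(u_1,\dots,u_n)$ and $w=(w_1,\dots,w_n)$ are convex: each lies on the boundary of its convex hull, and its turn angles are all $\ge 0$ or all $\le 0$. 3. There is a sign $\varepsilon\in\{1,-1\}$ such that at each interior vertex the turn angle of $u$ is $\varepsilon$ times, and that of $w$ is $-\varepsilon$ times, the sum of the angles of the two quadrilaterals incident to $p_i$, respectively $q_i$, minus $\pi$. If $\theta$ is the angle of the corresponding chain in space ($p_1,\dots,p_n$ for $u$, and $q_1,\dots,q_n$ for $w$) at this vertex, and $\tau_0=\pi-\theta$, then the turn angle lies in $[-\tau_0,\tau_0]$. The turn angles of $u$ and $w$ are either all $\ge 0$ or all $\le 0$. 4. Each of $u$ and $w$ is a valid straightening of a convex chain: there is a convex planar chain congruent to $p_1,\dots,p_n$ (respectively $q_1,\dots,q_n$) which has the same edge lengths as $u$ (respectively $w$), and whose turn angle at each interior vertex is in absolute value at least that of $u$ (respectively $w$). 5. $u$ and $w$ are simple: their edges are nondegenerate, consecutive edges meet only in their common vertex, and non-consecutive edges are disjoint. 6. The ladder edges $u_iw_i$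 are all parallel, and the curves $u$ and $w$ are disjoint. -/

import Mathlib

open Set

/-- Euclidean 3-space. -/
abbrev Space := EuclideanSpace ℝ (Fin 3)

/-- A lattice quadrilateral convex cap over the base rectangle `[1, nx] × [1, ny]`: the graph of a
concave function on the base (so the region below the graph is convex) whose part over every unit
lattice cell is planar.  Only the values of `height` on the base are relevant. -/
structure LatticeQuadConvexCap (nx ny : ℕ) where
  height : ℝ → ℝ → ℝ
  planar : ∀ i j : ℕ, 1 ≤ i → i < nx → 1 ≤ j → j < ny →
    ∃ a b c : ℝ, ∀ s ∈ Icc (i : ℝ) (i + 1), ∀ t ∈ Icc (j : ℝ) (j + 1),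
      height s t = a * s + b * t + c
  concave : ConcaveOn ℝ (Icc (1 : ℝ) nx ×ˢ Icc (1 : ℝ) ny) (fun p : ℝ × ℝ => height p.1 p.2)

/-- The combinatorial data of a strip of quadrilaterals: the quadrilaterals `face i` for
`1 ≤ i < n`, where `face i` has the corners `lower i`, `lower (i + 1)`, `upper (i + 1)`,
`upper i`.  The segments from `lower i` to `upper i` are the edges across the strip. -/
structure QuadStrip where
  n : ℕ
  lower : ℕ → Space
  upper : ℕ → Space
  face : ℕ → Set Space

/-- The surface of the strip. -/
def QuadStrip.surface (S : QuadStrip) : Set Space :=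
  {p | ∃ i, 1 ≤ i ∧ i < S.n ∧ p ∈ S.face i}

namespace LatticeQuadConvexCap

variable {nx ny : ℕ}

/-- The point of the cap above `(s, t)`. -/
noncomputable def point (C : LatticeQuadConvexCap nx ny) (s t : ℝ) : Space :=
  !₂[s, t, C.height s t]

/-- The quadrilateral of the cap above the lattice cell `[i, i + 1] × [j, j + 1]`. -/
def face (C : LatticeQuadConvexCap nx ny) (i j : ℕ) : Set Space :=
  {p | ∃ s ∈ Icc (i : ℝ) (i + 1), ∃ t ∈ Icc (j : ℝ) (j + 1), p = C.point s t}

/-- The `x`-strip between `y` and `y + 1`. -/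
noncomputable def xStrip (C : LatticeQuadConvexCap nx ny) (y : ℕ) : QuadStrip where
  n := nx
  lower i := C.point i y
  upper i := C.point i (y + 1)
  face i := C.face i y

/-- The `y`-strip between `x` and `x + 1`. -/
noncomputable def yStrip (C : LatticeQuadConvexCap nx ny) (x : ℕ) : QuadStrip where
  n := ny
  lower j := C.point x j
  upper j := C.point (x + 1) j
  face j := C.face x j

/-- `S` is one of the strips of quadrilaterals of the cap. -/
def IsStrip (C : LatticeQuadConvexCap nx ny) (S : QuadStrip) : Prop :=
  (∃ y : ℕ, 1 ≤ y ∧ y < ny ∧ S = C.xStrip y) ∨ (∃ x : ℕ, 1 ≤ x ∧ x < nx ∧ S = C.yStrip x)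

end LatticeQuadConvexCap

/-- `φ` unfolds the strip into the Euclidean plane `ℂ`: it is a map of the surface of the strip
(its values elsewhere are irrelevant) that is isometric on every quadrilateral and places any two
consecutive quadrilaterals on opposite sides of the line through their common edge. -/
structure IsUnfolding (S : QuadStrip) (φ : Space → ℂ) : Prop where
  isometric : ∀ i, 1 ≤ i → i < S.n → ∀ p ∈ S.face i, ∀ q ∈ S.face i,
    dist (φ p) (φ q) = dist p q
  opposite : ∀ i, 1 ≤ i → i + 2 ≤ S.n →
    (line[ℝ, φ (S.lower (i + 1)), φ (S.upper (i + 1))]).SOppSide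
      (φ (S.lower i)) (φ (S.lower (i + 2)))

/-! Polygonal chains `u 1, …, u n` in the plane. -/

/-- The point set of the chain, the union of its edges. -/
def chainCurve (n : ℕ) (u : ℕ → ℂ) : Set ℂ :=
  {z | ∃ i, 1 ≤ i ∧ i < n ∧ z ∈ segment ℝ (u i) (u (i + 1))}

/-- The signed turn angle, in `(-π, π]`, at the vertex `u (i + 1)` of the chain: the angle from
the direction of the edge that arrives there to that of the edge that leaves. -/
noncomputable def turnAngle (u : ℕ → ℂ) (i : ℕ) : ℝ :=
  Complex.arg ((u (i + 2) - u (i + 1)) / (u (i + 1) - u i))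

/-- The chain is a convex curve: it lies on the boundary of its convex hull, and it never turns
both left and right. -/
def IsConvexChain (n : ℕ) (u : ℕ → ℂ) : Prop :=
  chainCurve n u ⊆ frontier (convexHull ℝ (chainCurve n u)) ∧
  ((∀ i, 1 ≤ i → i + 2 ≤ n → 0 ≤ turnAngle u i) ∨
    (∀ i, 1 ≤ i → i + 2 ≤ n → turnAngle u i ≤ 0))

/-- The chain does not intersect itself: its edges are nondegenerate, consecutive edges meet only
in their common vertex, and any other two edges are disjoint. -/
def IsSimpleChain (n : ℕ) (u : ℕ → ℂ) : Prop :=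
  (∀ i, 1 ≤ i → i < n → u i ≠ u (i + 1)) ∧
  (∀ i, 1 ≤ i → i + 2 ≤ n →
    segment ℝ (u i) (u (i + 1)) ∩ segment ℝ (u (i + 1)) (u (i + 2)) = {u (i + 1)}) ∧
  (∀ i j, 1 ≤ i → i + 1 < j → j < n →
    Disjoint (segment ℝ (u i) (u (i + 1))) (segment ℝ (u j) (u (j + 1))))

/-- `u` is a valid straightening of the convex chain `c`: corresponding edges have equal lengths,
and every turn angle of `u` lies in `[-τ₀, τ₀]`, where `τ₀` is the size of the corresponding turn
angle of `c`. -/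
def IsValidStraightening (n : ℕ) (c u : ℕ → ℂ) : Prop :=
  IsConvexChain n c ∧
  (∀ i, 1 ≤ i → i < n → dist (u i) (u (i + 1)) = dist (c i) (c (i + 1))) ∧
  (∀ i, 1 ≤ i → i + 2 ≤ n → turnAngle u i ∈ Icc (-|turnAngle c i|) |turnAngle c i|)

/-- The planar chain `c` is a congruent copy of the chain `p 1, …, p n` in space. -/
def IsPlanarCopy (n : ℕ) (p : ℕ → Space) (c : ℕ → ℂ) : Prop :=
  ∀ i j, 1 ≤ i → i ≤ n → 1 ≤ j → j ≤ n → dist (c i) (c j) = dist (p i) (p j)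

/-- The turn angle `τ₀ = π - θ` of a chain in space at `p (i + 1)`, where `θ` is the angle
of the chain there. -/
noncomputable def spaceTurn (p : ℕ → Space) (i : ℕ) : ℝ :=
  Real.pi - EuclideanGeometry.angle (p i) (p (i + 1)) (p (i + 2))

/-- For a strip with boundary chains `p` and `q`: the sum of the angles at `p (i + 1)` of the two
quadrilaterals incident there, minus `π`. -/
noncomputable def quadTurn (p q : ℕ → Space) (i : ℕ) : ℝ :=
  EuclideanGeometry.angle (p i) (p (i + 1)) (q (i + 1)) +
    EuclideanGeometry.angle (q (i + 1)) (p (i + 1)) (p (i + 2)) - Real.pi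

/-!
The affine pieces of the cap over two adjacent cells agree along the common side of the cells, so
they have the same slope in the direction of that side.  Hence all ladder edges of a strip are
translates of one vector `e = (0, 1, b)`, the boundary edges are `v i = (1, 0, a i)` on both sides,
and the strip is part of a cylinder with generator `e` (`IsCylinderStrip`).  Concavity of the cap
says that the slopes `a i` decrease.

Unrolling the cylinder is an unfolding (`isUnfolding_unroll`).  Conversely, an unfolding is affine
on each parallelogram (`map_eq_of_dist_eq`), so it maps all ladder edges to translates of one vector
`E`, and in the frame of `E` the boundary edges are `(along, ± across)`, where these numbers are
determined by the Gram matrix of `e` and `v i`.  The condition on opposite sides makes the sign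
constant (`exists_sign`).  Both boundary curves thus have the same edge vectors, all of
them pointing to the same side of the direction `E`: the curves are graphs over the axis orthogonal
to `E`.  The slope `along / across` is a monotone function of `a i`, so the graphs are convex or
concave (`IsMonotoneSlopeChain`), which gives convexity, simplicity and the constant sign of the
turn angles.  The coordinate orthogonal to `E` separates the images of different parallelograms,
which excludes overlap (`injOn`).

The direction of an unfolded edge makes the angle `∠ (e, v i)` with `E`, so the turn angle is
`± (∠ (e, v (i + 1)) - ∠ (e, v i))`.  This is the formula with the quadrilateral angles, and by the
triangle inequality for angles it is bounded by `∠ (v i, v (i + 1))`, the turn angle of the chain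
in space (`abs_quadTurn_le_spaceTurn`).  The chain in space lies in a plane, where it is the graph
of a concave function, so `IsMonotoneSlopeChain` applies to its planar copy as well.
-/

/-! ### Convex planar chains with monotone slopes -/

/-- In the frame of the plane given by `ζ` and `ζ * I`, the chain `u 1, …, u n` has the edge
vectors `(x i, y i)` with `y i > 0`, so that it is the graph of a piecewise linear function over
the axis `ζ * I`, and the slopes `x i / y i` of this function are antitone (if `0 < κ`) or monotone
(if `κ < 0`).  The slope condition is stated without division. -/
structure IsMonotoneSlopeChain (n : ℕ) (u : ℕ → ℂ) (ζ : ℂ) (κ : ℝ) (x y : ℕ → ℝ) : Prop where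
  frame_ne : ζ ≠ 0
  sign_ne : κ ≠ 0
  edge : ∀ i, 1 ≤ i → i < n → u (i + 1) - u i = ζ * (x i + y i * Complex.I)
  pos : ∀ i, 1 ≤ i → i < n → 0 < y i
  slope : ∀ i j, 1 ≤ i → i ≤ j → j < n → 0 ≤ κ * (x i * y j - x j * y i)

lemma im_ratio (a b c d : ℝ) :
    (((a : ℂ) + b * Complex.I) / (c + d * Complex.I)).im =
      (c * b - a * d) / (c ^ 2 + d ^ 2) := by
  simp [Complex.div_im, Complex.normSq_apply]
  ring

lemma re_ratio (a b c d : ℝ) :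
    (((a : ℂ) + b * Complex.I) / (c + d * Complex.I)).re =
      (a * c + b * d) / (c ^ 2 + d ^ 2) := by
  simp [Complex.div_re, Complex.normSq_apply]
  ring

lemma add_mul_I_ne_zero (a : ℝ) {b : ℝ} (hb : b ≠ 0) : (a : ℂ) + b * Complex.I ≠ 0 := by
  intro h
  apply hb
  simpa using congrArg Complex.im h

/-- A closed half-plane that contains `s` and has the point `z` of `s` on its boundary line
certifies that `z` is on the boundary of the convex hull of `s`. -/
lemma mem_frontier_convexHull_of_im {s : Set ℂ} {z c a : ℂ} (hc : c ≠ 0) (hz : z ∈ s)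
    (hs : ∀ v ∈ s, 0 ≤ ((v - a) * c).im) (h0 : ((z - a) * c).im = 0) :
    z ∈ frontier (convexHull ℝ s) := by
  refine ⟨subset_closure (subset_convexHull ℝ s hz), fun hint => ?_⟩
  have hhalf : convexHull ℝ s ⊆ {v | 0 ≤ ((v - a) * c).im} := by
    refine convexHull_min hs ?_
    intro v hv w hw α β hα hβ hαβ
    have key : (α • v + β • w - a) * c = α * ((v - a) * c) + β * ((w - a) * c) := by
      have : (α : ℂ) + β = 1 := by exact_mod_cast hαβ
      simp only [Complex.real_smul]
      linear_combination (a * c) * this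
    simp only [mem_ofPred_eq] at hv hw ⊢
    rw [key]
    simp only [Complex.add_im, Complex.im_ofReal_mul]
    positivity
  have hcont : ContinuousAt (fun t : ℝ => z - t * (Complex.I / c)) 0 := by fun_prop
  have hev : ∀ᶠ t : ℝ in nhds 0, z - t * (Complex.I / c) ∈ convexHull ℝ s := by
    refine hcont.eventually_mem ?_
    simpa using mem_interior_iff_mem_nhds.1 hint
  obtain ⟨t, ht, htpos⟩ :=
    ((hev.filter_mono nhdsWithin_le_nhds).and (self_mem_nhdsWithin (s := Ioi (0 : ℝ)))).exists
  have h1 := hhalf ht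
  have h2 : (z - t * (Complex.I / c) - a) * c = (z - a) * c - t * Complex.I := by
    field_simp
    ring
  simp only [mem_ofPred_eq, h2, Complex.sub_im, h0] at h1
  simp at h1
  exact absurd htpos (not_lt.2 h1)

lemma mem_segment_iff_add_smul_sub {a b z : ℂ} :
    z ∈ segment ℝ a b ↔ ∃ t ∈ Icc (0 : ℝ) 1, z = a + t * (b - a) := by
  rw [segment_eq_image', mem_image]
  simp [eq_comm]

namespace IsMonotoneSlopeChain

variable {n : ℕ} {u : ℕ → ℂ} {ζ : ℂ} {κ : ℝ} {x y : ℕ → ℝ}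

lemma edge_ne (h : IsMonotoneSlopeChain n u ζ κ x y) {i : ℕ} (hi : 1 ≤ i) (hin : i < n) :
    u (i + 1) - u i ≠ 0 := by
  rw [h.edge i hi hin]
  exact mul_ne_zero h.frame_ne (add_mul_I_ne_zero _ (h.pos i hi hin).ne')

lemma edge_div (h : IsMonotoneSlopeChain n u ζ κ x y) {i j : ℕ} (hi : 1 ≤ i) (hin : i < n)
    (hj : 1 ≤ j) (hjn : j < n) :
    (u (j + 1) - u j) / (u (i + 1) - u i) =
      (x j + y j * Complex.I) / (x i + y i * Complex.I) := by
  rw [h.edge i hi hin, h.edge j hj hjn, mul_div_mul_left _ _ h.frame_ne]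

/-- The line through the `i`-th edge supports the chain. -/
lemma im_vertex_nonneg (h : IsMonotoneSlopeChain n u ζ κ x y) {i k : ℕ} (hi : 1 ≤ i) (hin : i < n)
    (hk : 1 ≤ k) (hkn : k ≤ n) : 0 ≤ κ * ((u k - u i) / (u (i + 1) - u i)).im := by
  have step : ∀ j, κ * ((u (j + 1) - u i) / (u (i + 1) - u i)).im =
      κ * ((u j - u i) / (u (i + 1) - u i)).im +
        κ * ((u (j + 1) - u j) / (u (i + 1) - u i)).im := by
    intro j
    rw [← mul_add, ← Complex.add_im, ← add_div]
    ring_nf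
  have hpos : 0 < x i ^ 2 + y i ^ 2 := by
    have := h.pos i hi hin
    positivity
  rcases le_total i k with hik | hki
  · induction k, hik using Nat.le_induction with
    | base => simp
    | succ j hij ih =>
      rw [step]
      refine add_nonneg (ih (by omega) (by omega)) ?_
      rw [h.edge_div hi hin (by omega) (by omega), im_ratio, mul_div_assoc']
      exact div_nonneg (h.slope i j hi hij (by omega)) hpos.le
  · obtain ⟨d, rfl⟩ := Nat.exists_eq_add_of_le hki
    have back : ∀ e ≤ d, 0 ≤ κ * ((u (k + d - e) - u (k + d)) /
        (u (k + d + 1) - u (k + d))).im := by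
      intro e
      induction e with
      | zero => simp
      | succ e ih =>
        intro he
        have h1 := ih (by omega)
        obtain ⟨j, hj⟩ : ∃ j, k + d - (e + 1) = j := ⟨_, rfl⟩
        have hj' : k + d - e = j + 1 := by omega
        rw [hj', step, h.edge_div hi hin (by omega) (by omega), im_ratio, mul_div_assoc'] at h1
        rw [hj]
        have h2 : κ * (x (k + d) * y j - x j * y (k + d)) / (x (k + d) ^ 2 + y (k + d) ^ 2) ≤ 0 := by
          refine div_nonpos_of_nonpos_of_nonneg ?_ hpos.le
          linarith [h.slope j (k + d) (by omega) (by omega) hin]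
        linarith
    simpa using back d le_rfl

lemma turnAngle_sign (h : IsMonotoneSlopeChain n u ζ κ x y) {i : ℕ} (hi : 1 ≤ i)
    (hin : i + 2 ≤ n) : 0 ≤ κ * turnAngle u i := by
  have hy := h.pos i hi (by omega)
  have hy' := h.pos (i + 1) (by omega) (by omega)
  have hpos : 0 < x i ^ 2 + y i ^ 2 := by positivity
  have hs := h.slope i (i + 1) hi (by omega) (by omega)
  unfold turnAngle
  rw [h.edge_div hi (by omega) (by omega : 1 ≤ i + 1) (by omega)]
  set q := ((x (i + 1) : ℂ) + y (i + 1) * Complex.I) / (x i + y i * Complex.I) with hq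
  have him : q.im = (x i * y (i + 1) - x (i + 1) * y i) / (x i ^ 2 + y i ^ 2) := im_ratio _ _ _ _
  have hre : q.re = (x (i + 1) * x i + y (i + 1) * y i) / (x i ^ 2 + y i ^ 2) := re_ratio _ _ _ _
  have hκ : 0 ≤ κ * q.im := by
    rw [him, mul_div_assoc']
    exact div_nonneg hs hpos.le
  rcases lt_or_gt_of_ne h.sign_ne with hneg | hpos'
  · have him0 : q.im ≤ 0 := by
      by_contra! hlt
      nlinarith
    refine mul_nonneg_of_nonpos_of_nonpos hneg.le ?_
    rcases him0.lt_or_eq with hlt | heq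
    · exact (Complex.arg_neg_iff.2 hlt).le
    · -- Edges of equal slope point in the same direction, so the angle is `0` rather than `π`.
      have hpar : x i * y (i + 1) = x (i + 1) * y i := by
        rw [him, div_eq_zero_iff] at heq
        rcases heq with heq | heq
        · linarith
        · exact absurd heq hpos.ne'
      have hre0 : 0 ≤ q.re := by
        rw [hre]
        refine div_nonneg ?_ hpos.le
        have : 0 ≤ (x (i + 1) * x i + y (i + 1) * y i) * (y i * y (i + 1)) := by
          have : (x (i + 1) * x i + y (i + 1) * y i) * (y i * y (i + 1)) =
              (x i * y (i + 1)) ^ 2 + (y i * y (i + 1)) ^ 2 := by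
            linear_combination (-x i * y (i + 1)) * hpar
          rw [this]
          positivity
        exact nonneg_of_mul_nonneg_left this (mul_pos hy hy')
      exact (Complex.arg_eq_zero_iff.2 ⟨hre0, heq⟩).le
  · refine mul_nonneg hpos'.le (Complex.arg_nonneg_iff.2 ?_)
    exact nonneg_of_mul_nonneg_right hκ hpos'

theorem isConvexChain (h : IsMonotoneSlopeChain n u ζ κ x y) : IsConvexChain n u := by
  constructor
  · rintro z ⟨i, hi, hin, hz⟩
    have hD := h.edge_ne hi hin
    refine mem_frontier_convexHull_of_im (c := κ / (u (i + 1) - u i)) (a := u i)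
      (div_ne_zero (by exact_mod_cast h.sign_ne) hD) ⟨i, hi, hin, hz⟩ ?_ ?_
    · rintro v ⟨j, hj, hjn, hv⟩
      obtain ⟨t, ht, rfl⟩ := mem_segment_iff_add_smul_sub.1 hv
      have h1 := h.im_vertex_nonneg hi hin hj hjn.le
      have h2 := h.im_vertex_nonneg hi hin (by omega : 1 ≤ j + 1) hjn
      have key : (u j + t * (u (j + 1) - u j) - u i) * (κ / (u (i + 1) - u i)) =
          ((1 - t : ℝ) : ℂ) * ((κ : ℂ) * ((u j - u i) / (u (i + 1) - u i))) +
            (t : ℂ) * ((κ : ℂ) * ((u (j + 1) - u i) / (u (i + 1) - u i))) := by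
        push_cast
        ring
      rw [key, Complex.add_im, Complex.im_ofReal_mul, Complex.im_ofReal_mul,
        Complex.im_ofReal_mul, Complex.im_ofReal_mul]
      exact add_nonneg (mul_nonneg (by linarith [ht.2]) h1) (mul_nonneg ht.1 h2)
    · obtain ⟨t, ht, rfl⟩ := mem_segment_iff_add_smul_sub.1 hz
      have key : (u i + t * (u (i + 1) - u i) - u i) * (κ / (u (i + 1) - u i)) =
          ((t * κ : ℝ) : ℂ) := by
        push_cast
        field_simp
        ring
      rw [key, Complex.ofReal_im]
  · rcases lt_or_gt_of_ne h.sign_ne with hneg | hpos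
    · right
      intro i hi hin
      have := h.turnAngle_sign hi hin
      by_contra! hlt
      nlinarith
    · left
      intro i hi hin
      exact nonneg_of_mul_nonneg_right (h.turnAngle_sign hi hin) hpos

/-- The coordinate along the axis `ζ * I` of the frame increases along each edge. -/
lemma im_edge_point (h : IsMonotoneSlopeChain n u ζ κ x y) {i : ℕ} (hi : 1 ≤ i) (hin : i < n)
    (t : ℝ) : ((u i + t * (u (i + 1) - u i)) / ζ).im = (u i / ζ).im + t * y i := by
  have h1 := h.edge i hi hin
  have h2 := h.frame_ne
  have key : (u i + t * (u (i + 1) - u i)) / ζ =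
      u i / ζ + ((t * x i : ℝ) : ℂ) + ((t * y i : ℝ) : ℂ) * Complex.I := by
    rw [h1]
    push_cast
    field_simp
    ring
  rw [key]
  simp

lemma im_vertex_succ (h : IsMonotoneSlopeChain n u ζ κ x y) {i : ℕ} (hi : 1 ≤ i) (hin : i < n) :
    (u (i + 1) / ζ).im = (u i / ζ).im + y i := by
  simpa using h.im_edge_point hi hin 1

lemma im_vertex_lt (h : IsMonotoneSlopeChain n u ζ κ x y) {i j : ℕ} (hi : 1 ≤ i) (hij : i < j)
    (hjn : j ≤ n) : (u i / ζ).im < (u j / ζ).im := by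
  induction j, hij using Nat.le_induction with
  | base =>
    rw [Nat.succ_eq_add_one, h.im_vertex_succ hi hjn]
    linarith [h.pos i hi hjn]
  | succ k hik ih =>
    have hk : i + 1 ≤ k := hik
    rw [h.im_vertex_succ (by omega) hjn]
    linarith [ih (by omega), h.pos k (by omega) hjn]

theorem isSimpleChain (h : IsMonotoneSlopeChain n u ζ κ x y) : IsSimpleChain n u := by
  refine ⟨fun i hi hin heq => h.edge_ne hi hin (by rw [heq, sub_self]), ?_, ?_⟩
  · intro i hi hin
    apply Subset.antisymm
    · rintro z ⟨hz, hz'⟩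
      obtain ⟨s, hs, rfl⟩ := mem_segment_iff_add_smul_sub.1 hz
      obtain ⟨t, ht, hst⟩ := mem_segment_iff_add_smul_sub.1 hz'
      have h1 := h.im_edge_point hi (by omega) s
      have h2 := h.im_edge_point (by omega : 1 ≤ i + 1) (by omega) t
      have hy := h.pos i hi (by omega)
      have hy' := h.pos (i + 1) (by omega) (by omega)
      rw [hst, h2, h.im_vertex_succ hi (by omega)] at h1
      have hs1 : s = 1 := by
        refine le_antisymm hs.2 ?_
        nlinarith [mul_nonneg ht.1 hy'.le]
      simp [hs1]
    · rintro z rfl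
      exact ⟨right_mem_segment _ _ _, left_mem_segment _ _ _⟩
  · intro i j hi hij hjn
    rw [Set.disjoint_left]
    intro z hz hz'
    obtain ⟨s, hs, rfl⟩ := mem_segment_iff_add_smul_sub.1 hz
    obtain ⟨t, ht, hst⟩ := mem_segment_iff_add_smul_sub.1 hz'
    have h1 := h.im_edge_point hi (by omega) s
    have h2 := h.im_edge_point (by omega : 1 ≤ j) hjn t
    have h3 := h.im_vertex_lt (by omega : 1 ≤ i + 1) hij hjn.le
    rw [hst, h2] at h1
    rw [h.im_vertex_succ hi (by omega)] at h3
    nlinarith [mul_nonneg ht.1 (h.pos j (by omega) hjn).le, h.pos i hi (by omega), hs.2]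

end IsMonotoneSlopeChain

/-! ### Coordinates in space -/

/-- The point with the coordinates `x`, `y`, `z` in the orthonormal basis `f`. -/
noncomputable def pt (f : OrthonormalBasis (Fin 3) ℝ Space) (x y z : ℝ) : Space :=
  x • f 0 + y • f 1 + z • f 2

section Coordinates

variable (f : OrthonormalBasis (Fin 3) ℝ Space)

lemma inner_pt (x y z x' y' z' : ℝ) :
    inner ℝ (pt f x y z) (pt f x' y' z') = x * x' + y * y' + z * z' := by
  simp [pt, inner_add_left, inner_add_right, inner_smul_left, inner_smul_right]
  ring

lemma norm_pt (x y z : ℝ) : ‖pt f x y z‖ = √(x ^ 2 + y ^ 2 + z ^ 2) := by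
  rw [norm_eq_sqrt_real_inner, inner_pt]
  ring_nf

lemma pt_sub (x y z x' y' z' : ℝ) :
    pt f x y z - pt f x' y' z' = pt f (x - x') (y - y') (z - z') := by
  simp only [pt]
  module

lemma pt_coord_zero (x y z : ℝ) : inner ℝ (f 0) (pt f x y z) = x := by
  simp [pt, inner_add_right, inner_smul_right]

lemma pt_coord_one (x y z : ℝ) : inner ℝ (f 1) (pt f x y z) = y := by
  simp [pt, inner_add_right, inner_smul_right]

end Coordinates

/-! ### The direction of an edge relative to the ladder -/

/-- In the plane of a parallelogram with the sides `e = (0, 1, b)` and `v = (1, 0, a)`, the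
coordinate of `v` along `e`, in units of the length of `e`. -/
noncomputable def along (b a : ℝ) : ℝ := a * b / (1 + b ^ 2)

/-- In the plane of a parallelogram with the sides `e = (0, 1, b)` and `v = (1, 0, a)`, the
coordinate of `v` orthogonal to `e`, in units of the length of `e`. -/
noncomputable def across (b a : ℝ) : ℝ := √(1 + a ^ 2 + b ^ 2) / (1 + b ^ 2)

lemma across_pos (b a : ℝ) : 0 < across b a := by
  unfold across
  positivity

lemma along_sq_add_across_sq (b a : ℝ) :
    along b a ^ 2 + across b a ^ 2 = (1 + a ^ 2) / (1 + b ^ 2) := by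
  unfold along across
  rw [div_pow, div_pow, Real.sq_sqrt (by positivity)]
  field_simp
  ring

/-- Monotonicity of `t / √(c + t ^ 2)`. -/
lemma mul_sqrt_add_sq_le {c s t : ℝ} (hc : 0 ≤ c) (hst : s ≤ t) :
    s * √(c + t ^ 2) ≤ t * √(c + s ^ 2) := by
  have key : ∀ s t : ℝ, 0 ≤ s → s ≤ t → s * √(c + t ^ 2) ≤ t * √(c + s ^ 2) := by
    intro s t hs hst
    refine abs_le_of_sq_le_sq' ?_ (mul_nonneg (hs.trans hst) (Real.sqrt_nonneg _)) |>.2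
    rw [mul_pow, mul_pow, Real.sq_sqrt (by positivity), Real.sq_sqrt (by positivity)]
    nlinarith [mul_nonneg hc (sub_nonneg.2 (pow_le_pow_left₀ hs hst 2))]
  rcases le_total 0 s with hs | hs
  · exact key s t hs hst
  · rcases le_total 0 t with ht | ht
    · exact (mul_nonpos_of_nonpos_of_nonneg hs (Real.sqrt_nonneg _)).trans (by positivity)
    · have := key (-t) (-s) (by linarith) (by linarith)
      simp only [even_two.neg_pow] at this
      linarith

/-- The direction of `v = (1, 0, a)` relative to the ladder edge is a monotone function of the
slope `a`; whether it increases or decreases depends on the sign of the slope `b` of the ladder. -/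
lemma exists_sign_along_across (b : ℝ) : ∃ κ : ℝ, κ ≠ 0 ∧ ∀ a a' : ℝ, a' ≤ a →
    0 ≤ κ * (along b a * across b a' - along b a' * across b a) := by
  have key : ∀ a a' : ℝ, along b a * across b a' - along b a' * across b a =
      b * ((a * √(1 + b ^ 2 + a' ^ 2) - a' * √(1 + b ^ 2 + a ^ 2)) / (1 + b ^ 2) ^ 2) := by
    intro a a'
    unfold along across
    rw [add_right_comm 1 (b ^ 2), add_right_comm 1 (b ^ 2)]
    field_simp
  rcases eq_or_ne b 0 with rfl | hb
  · exact ⟨1, one_ne_zero, fun a a' _ => by simp [along]⟩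
  · refine ⟨b, hb, fun a a' h => ?_⟩
    rw [key, ← mul_assoc]
    refine mul_nonneg (mul_self_nonneg b) (div_nonneg ?_ (by positivity))
    linarith [mul_sqrt_add_sq_le (c := 1 + b ^ 2) (by positivity) h]

/-- The angle between a ladder edge and a boundary edge is the argument of the boundary edge when
it is laid out in the upper half-plane with the ladder edge along the positive real axis. -/
lemma angle_ladder_edge (f : OrthonormalBasis (Fin 3) ℝ Space) (b a : ℝ) :
    InnerProductGeometry.angle (pt f 0 1 b) (pt f 1 0 a) =
      Complex.arg (along b a + across b a * Complex.I) := by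
  have hz := add_mul_I_ne_zero (along b a) (across_pos b a).ne'
  have harg : 0 ≤ Complex.arg (along b a + across b a * Complex.I) := by
    rw [Complex.arg_nonneg_iff]
    simpa using (across_pos b a).le
  have h := Complex.angle_eq_abs_arg hz one_ne_zero
  rw [div_one, abs_of_nonneg harg] at h
  rw [← h, InnerProductGeometry.angle, InnerProductGeometry.angle, inner_pt, norm_pt, norm_pt]
  congr 1
  have hn : ‖(along b a + across b a * Complex.I : ℂ)‖ = √(1 + a ^ 2) / √(1 + b ^ 2) := by
    rw [← Real.sqrt_div (by positivity), ← along_sq_add_across_sq, Complex.norm_add_mul_I]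
  rw [hn, norm_one, Complex.inner]
  have h1 : √(1 + b ^ 2) ^ 2 = 1 + b ^ 2 := Real.sq_sqrt (by positivity)
  have h2 : 0 < √(1 + b ^ 2) := by positivity
  have h3 : 0 < √(1 + a ^ 2) := by positivity
  simp
  rw [along]
  field_simp
  rw [h1]

lemma arg_div_of_im_pos {z w : ℂ} (hz : 0 < z.im) (hw : 0 < w.im) :
    Complex.arg (w / z) = Complex.arg w - Complex.arg z := by
  have hz0 : z ≠ 0 := by
    rintro rfl
    simp at hz
  have hw0 : w ≠ 0 := by
    rintro rfl
    simp at hw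
  have bounds : ∀ v : ℂ, 0 < v.im → 0 ≤ v.arg ∧ v.arg < Real.pi := by
    intro v hv
    refine ⟨Complex.arg_nonneg_iff.2 hv.le, (Complex.arg_le_pi v).lt_of_ne ?_⟩
    rw [Ne, Complex.arg_eq_pi_iff]
    exact fun h => hv.ne' h.2
  have hzb := bounds z hz
  have hwb := bounds w hw
  have hinv : (z⁻¹).arg = -z.arg := by
    rw [Complex.arg_inv, if_neg hzb.2.ne]
  rw [div_eq_mul_inv, Complex.arg_mul hw0 (inv_ne_zero hz0), hinv, sub_eq_add_neg]
  rw [hinv]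
  constructor <;> linarith [hzb.1, hzb.2, hwb.1, hwb.2]

/-- Turning from one edge direction to another; for `σ = -1` both are reflected in the imaginary
axis. -/
lemma arg_div_sign {σ : ℝ} (hσ : σ = 1 ∨ σ = -1) (x x' : ℝ) {y y' : ℝ} (hy : 0 < y)
    (hy' : 0 < y') :
    Complex.arg (((σ * x' : ℝ) + y' * Complex.I) / ((σ * x : ℝ) + y * Complex.I)) =
      σ * (Complex.arg (x' + y' * Complex.I) - Complex.arg (x + y * Complex.I)) := by
  have h := arg_div_of_im_pos (z := x + y * Complex.I) (w := x' + y' * Complex.I)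
    (by simpa using hy) (by simpa using hy')
  rcases hσ with rfl | rfl
  · simpa using h
  · have hconj : (((-1 * x' : ℝ) : ℂ) + y' * Complex.I) / (((-1 * x : ℝ) : ℂ) + y * Complex.I) =
        starRingEnd ℂ ((x' + y' * Complex.I) / (x + y * Complex.I)) := by
      rw [← neg_div_neg_eq]
      simp [add_comm]
    have hpi : Complex.arg ((x' + y' * Complex.I) / (x + y * Complex.I)) ≠ Real.pi := by
      rw [h]
      have h1 := Complex.arg_le_pi (x' + y' * Complex.I)
      have h2 : 0 < Complex.arg (x + y * Complex.I) := by
        refine lt_of_le_of_ne (Complex.arg_nonneg_iff.2 (by simpa using hy.le)) fun h0 => ?_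
        have := (Complex.arg_eq_zero_iff.1 h0.symm).2
        simp at this
        exact hy.ne' this
      linarith
    rw [hconj, Complex.arg_conj, if_neg hpi, h]
    ring

/-! ### Isometries and lines in the plane -/

/-- Polarization: a map that preserves distances preserves the inner products of difference
vectors. -/
lemma inner_map_sub_map {V W : Type*} [NormedAddCommGroup V] [InnerProductSpace ℝ V]
    [NormedAddCommGroup W] [InnerProductSpace ℝ W] {φ : V → W} {F : Set V}
    (hφ : ∀ p ∈ F, ∀ q ∈ F, dist (φ p) (φ q) = dist p q) {p₀ x y : V} (h₀ : p₀ ∈ F) (hx : x ∈ F)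
    (hy : y ∈ F) : inner ℝ (φ x - φ p₀) (φ y - φ p₀) = inner ℝ (x - p₀) (y - p₀) := by
  rw [real_inner_eq_norm_mul_self_add_norm_mul_self_sub_norm_sub_mul_self_div_two,
    real_inner_eq_norm_mul_self_add_norm_mul_self_sub_norm_sub_mul_self_div_two,
    sub_sub_sub_cancel_right, sub_sub_sub_cancel_right, ← dist_eq_norm, ← dist_eq_norm,
    ← dist_eq_norm, ← dist_eq_norm, ← dist_eq_norm, ← dist_eq_norm, hφ x hx p₀ h₀,
    hφ y hy p₀ h₀, hφ x hx y hy]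

/-- A map that preserves the distances between four points of a plane, three of which are given
by `p₀`, `p₀ + v`, `p₀ + e`, preserves the affine coordinates of the fourth: it preserves
the Gram matrix of the difference vectors. -/
lemma map_eq_of_dist_eq {V W : Type*} [NormedAddCommGroup V] [InnerProductSpace ℝ V]
    [NormedAddCommGroup W] [InnerProductSpace ℝ W] {φ : V → W} {F : Set V}
    (hφ : ∀ p ∈ F, ∀ q ∈ F, dist (φ p) (φ q) = dist p q) {p₀ p₁ q₀ p : V}
    (h₀ : p₀ ∈ F) (h₁ : p₁ ∈ F) (h₂ : q₀ ∈ F) (hp : p ∈ F) {s t : ℝ}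
    (h : p - p₀ = s • (p₁ - p₀) + t • (q₀ - p₀)) :
    φ p - φ p₀ = s • (φ p₁ - φ p₀) + t • (φ q₀ - φ p₀) := by
  have hin : ∀ x ∈ F, ∀ y ∈ F, inner ℝ (φ x - φ p₀) (φ y - φ p₀) = inner ℝ (x - p₀) (y - p₀) :=
    fun x hx y hy => inner_map_sub_map hφ h₀ hx hy
  have hzero : inner ℝ (p - p₀ - (s • (p₁ - p₀) + t • (q₀ - p₀)))
      (p - p₀ - (s • (p₁ - p₀) + t • (q₀ - p₀))) = (0 : ℝ) := by
    rw [h, sub_self, inner_zero_left]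
  rw [← sub_eq_zero, ← inner_self_eq_zero (𝕜 := ℝ), ← hzero]
  generalize hP : p - p₀ = P at *
  generalize hQ : p₁ - p₀ = Q at *
  generalize hR : q₀ - p₀ = R at *
  have e1 := hin p hp p hp
  have e2 := hin p hp p₁ h₁
  have e3 := hin p hp q₀ h₂
  have e4 := hin p₁ h₁ p hp
  have e5 := hin p₁ h₁ p₁ h₁
  have e6 := hin p₁ h₁ q₀ h₂
  have e7 := hin q₀ h₂ p hp
  have e8 := hin q₀ h₂ p₁ h₁
  have e9 := hin q₀ h₂ q₀ h₂
  rw [hP] at e1 e2 e3 e4 e7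
  rw [hQ] at e2 e4 e5 e6 e8
  rw [hR] at e3 e6 e7 e8 e9
  generalize φ p - φ p₀ = A at *
  generalize φ p₁ - φ p₀ = B at *
  generalize φ q₀ - φ p₀ = D at *
  simp only [inner_sub_left, inner_sub_right, inner_add_left, inner_add_right, inner_smul_left,
    inner_smul_right, e1, e2, e3, e4, e5, e6, e7, e8, e9]

open scoped Affine in
lemma mem_line_iff_im_eq_zero {c w z : ℂ} (h : w ≠ c) :
    z ∈ line[ℝ, c, w] ↔ ((z - c) / (w - c)).im = 0 := by
  have h0 : w - c ≠ 0 := sub_ne_zero.2 h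
  constructor
  · intro hz
    obtain ⟨r, rfl⟩ := mem_affineSpan_pair_iff_exists_lineMap_eq.1 hz
    have : (AffineMap.lineMap c w r - c) / (w - c) = ((r : ℝ) : ℂ) := by
      simp [AffineMap.lineMap_apply]
      field_simp
    rw [this, Complex.ofReal_im]
  · intro hz
    have : z = AffineMap.lineMap c w ((z - c) / (w - c)).re := by
      have h1 : ((((z - c) / (w - c)).re : ℝ) : ℂ) = (z - c) / (w - c) :=
        Complex.ext rfl (by rw [Complex.ofReal_im, hz])
      rw [AffineMap.lineMap_apply, vsub_eq_sub, vadd_eq_add, Complex.real_smul, h1]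
      field_simp
      ring
    rw [this]
    exact AffineMap.lineMap_mem_affineSpan_pair _ _ _

open scoped Affine in
lemma line_parallel_of_sub_eq {p q p' q' : ℂ} (h : q - p = q' - p') :
    line[ℝ, p, q] ∥ line[ℝ, p', q'] := by
  rw [AffineSubspace.affineSpan_pair_parallel_iff_vectorSpan_eq, vectorSpan_pair_rev,
    vectorSpan_pair_rev, vsub_eq_sub, vsub_eq_sub, h]

/-- A vector with given length and given inner product with `E` is determined up to the
reflection in the line of `E`. -/
lemma exists_sign_of_gram {E D : ℂ} {a b : ℝ} (hE : inner ℝ E E = 1 + b ^ 2)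
    (hD : inner ℝ D D = 1 + a ^ 2) (hED : inner ℝ E D = a * b) :
    ∃ σ : ℝ, (σ = 1 ∨ σ = -1) ∧
      D = E * (along b a + (σ * across b a : ℝ) * Complex.I) := by
  have hb : (0 : ℝ) < 1 + b ^ 2 := by positivity
  have hE0 : E ≠ 0 := by
    rintro rfl
    simp at hE
    linarith
  rw [Complex.inner] at hE hD hED
  simp only [Complex.mul_re, Complex.conj_re, Complex.conj_im] at hE hD hED
  obtain ⟨δ, rfl⟩ : ∃ δ, D = E * δ := ⟨D / E, by field_simp⟩
  simp only [Complex.mul_re, Complex.mul_im] at hD hED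
  have hre : δ.re = along b a := by
    unfold along
    rw [eq_div_iff hb.ne', ← hE]
    linear_combination hED
  have hsq : δ.im ^ 2 = across b a ^ 2 := by
    have h1 := along_sq_add_across_sq b a
    rw [← hre, eq_div_iff hb.ne', ← hD, ← hE] at h1
    have h2 : (δ.im ^ 2 - across b a ^ 2) * (1 + b ^ 2) = 0 := by
      rw [← hE]
      linear_combination -h1
    rcases mul_eq_zero.1 h2 with h3 | h3
    · linarith
    · exact absurd h3 hb.ne'
  rcases sq_eq_sq_iff_eq_or_eq_neg.1 hsq with h | h
  · refine ⟨1, Or.inl rfl, ?_⟩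
    rw [← Complex.re_add_im δ, hre, h]
    simp
  · refine ⟨-1, Or.inr rfl, ?_⟩
    rw [← Complex.re_add_im δ, hre, h]
    simp

/-! ### Cylindrical strips -/

/-- The strip is part of a cylinder, with all ladder edges translates of the vector `(0, 1, b)` and
the vertices `(i, y₀, h i)` of its lower boundary chain the graph of a concave sequence.  The
coordinates are with respect to the basis `f`, which exchanges the roles of the first two
coordinates in the case of a `y`-strip; `a i` is the slope of the `i`-th boundary edges. -/
structure IsCylinderStrip (S : QuadStrip) (f : OrthonormalBasis (Fin 3) ℝ Space)
    (y₀ b : ℝ) (h a : ℕ → ℝ) : Prop where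
  step : ∀ i, h (i + 1) = h i + a i
  concave : ∀ i, 1 ≤ i → i + 2 ≤ S.n → a (i + 1) ≤ a i
  lower : ∀ i, 1 ≤ i → i ≤ S.n → S.lower i = pt f i y₀ (h i)
  upper : ∀ i, 1 ≤ i → i ≤ S.n → S.upper i = pt f i (y₀ + 1) (h i + b)
  face : ∀ i, 1 ≤ i → i < S.n → S.face i =
    {p | ∃ s ∈ Icc (0 : ℝ) 1, ∃ t ∈ Icc (0 : ℝ) 1,
      p = pt f (i + s) (y₀ + t) (h i + s * a i + t * b)}

namespace IsCylinderStrip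

variable {S : QuadStrip} {f : OrthonormalBasis (Fin 3) ℝ Space} {y₀ b : ℝ} {h a : ℕ → ℝ}

lemma slope_antitone (hS : IsCylinderStrip S f y₀ b h a) {i j : ℕ} (hi : 1 ≤ i) (hij : i ≤ j)
    (hj : j < S.n) : a j ≤ a i := by
  induction j, hij using Nat.le_induction with
  | base => exact le_rfl
  | succ k hik ih => exact (hS.concave k (by omega) (by omega)).trans (ih (by omega))

lemma mem_face (hS : IsCylinderStrip S f y₀ b h a) {i : ℕ} (hi : 1 ≤ i) (hin : i < S.n) {s t : ℝ}
    (hs : s ∈ Icc (0 : ℝ) 1) (ht : t ∈ Icc (0 : ℝ) 1) :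
    pt f (i + s) (y₀ + t) (h i + s * a i + t * b) ∈ S.face i := by
  rw [hS.face i hi hin]
  exact ⟨s, hs, t, ht, rfl⟩

lemma lower_eq (hS : IsCylinderStrip S f y₀ b h a) {i : ℕ} (hi : 1 ≤ i) (hin : i < S.n) :
    S.lower i = pt f (i + (0 : ℝ)) (y₀ + (0 : ℝ)) (h i + 0 * a i + 0 * b) := by
  rw [hS.lower i hi hin.le]
  simp

lemma lower_succ_eq (hS : IsCylinderStrip S f y₀ b h a) {i : ℕ} (hi : 1 ≤ i) (hin : i < S.n) :
    S.lower (i + 1) = pt f (i + (1 : ℝ)) (y₀ + (0 : ℝ)) (h i + 1 * a i + 0 * b) := by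
  rw [hS.lower (i + 1) (by omega) hin, hS.step]
  simp

lemma upper_eq (hS : IsCylinderStrip S f y₀ b h a) {i : ℕ} (hi : 1 ≤ i) (hin : i < S.n) :
    S.upper i = pt f (i + (0 : ℝ)) (y₀ + (1 : ℝ)) (h i + 0 * a i + 1 * b) := by
  rw [hS.upper i hi hin.le]
  simp

lemma upper_succ_eq (hS : IsCylinderStrip S f y₀ b h a) {i : ℕ} (hi : 1 ≤ i) (hin : i < S.n) :
    S.upper (i + 1) = pt f (i + (1 : ℝ)) (y₀ + (1 : ℝ)) (h i + 1 * a i + 1 * b) := by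
  rw [hS.upper (i + 1) (by omega) hin, hS.step]
  simp

lemma corners_mem (hS : IsCylinderStrip S f y₀ b h a) {i : ℕ} (hi : 1 ≤ i) (hin : i < S.n) :
    S.lower i ∈ S.face i ∧ S.lower (i + 1) ∈ S.face i ∧ S.upper i ∈ S.face i ∧
      S.upper (i + 1) ∈ S.face i := by
  rw [hS.lower_eq hi hin, hS.lower_succ_eq hi hin, hS.upper_eq hi hin, hS.upper_succ_eq hi hin]
  refine ⟨?_, ?_, ?_, ?_⟩ <;> apply hS.mem_face hi hin <;> simp

/-! ### The shape of an unfolding -/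

section Unfolding

variable {φ : Space → ℂ}

/-- An unfolding is affine on each parallelogram. -/
lemma map_face (hS : IsCylinderStrip S f y₀ b h a) (hφ : IsUnfolding S φ) {i : ℕ} (hi : 1 ≤ i)
    (hin : i < S.n) {s t : ℝ} (hs : s ∈ Icc (0 : ℝ) 1) (ht : t ∈ Icc (0 : ℝ) 1) :
    φ (pt f (i + s) (y₀ + t) (h i + s * a i + t * b)) =
      φ (S.lower i) + s * (φ (S.lower (i + 1)) - φ (S.lower i)) +
        t * (φ (S.upper i) - φ (S.lower i)) := by
  obtain ⟨h0, h1, h2, -⟩ := hS.corners_mem hi hin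
  have key := map_eq_of_dist_eq (hφ.isometric i hi hin) h0 h1 h2 (hS.mem_face hi hin hs ht)
    (s := s) (t := t) (by
      rw [hS.lower_eq hi hin, hS.lower_succ_eq hi hin, hS.upper_eq hi hin]
      simp only [pt]
      module)
  simp only [Complex.real_smul] at key
  linear_combination key

/-- The ladder edges are opposite sides of the parallelograms, so their images are translates of
each other. -/
lemma ladder_const (hS : IsCylinderStrip S f y₀ b h a) (hφ : IsUnfolding S φ) {i : ℕ} (hi : 1 ≤ i)
    (hin : i ≤ S.n) : φ (S.upper i) - φ (S.lower i) = φ (S.upper 1) - φ (S.lower 1) := by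
  induction i, hi using Nat.le_induction with
  | base => rfl
  | succ k hk ih =>
    rw [← ih (by omega)]
    have h1 : (1 : ℝ) ∈ Icc (0 : ℝ) 1 := by simp
    have key := hS.map_face hφ hk hin h1 h1
    rw [← hS.upper_succ_eq hk hin] at key
    push_cast at key
    linear_combination key

lemma gram (hS : IsCylinderStrip S f y₀ b h a) (hφ : IsUnfolding S φ) {i : ℕ} (hi : 1 ≤ i)
    (hin : i < S.n) :
    inner ℝ (φ (S.upper i) - φ (S.lower i)) (φ (S.upper i) - φ (S.lower i)) = 1 + b ^ 2 ∧
    inner ℝ (φ (S.lower (i + 1)) - φ (S.lower i)) (φ (S.lower (i + 1)) - φ (S.lower i)) =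
      1 + a i ^ 2 ∧
    inner ℝ (φ (S.upper i) - φ (S.lower i)) (φ (S.lower (i + 1)) - φ (S.lower i)) = a i * b := by
  obtain ⟨h0, h1, h2, -⟩ := hS.corners_mem hi hin
  have hin' : ∀ x ∈ S.face i, ∀ y ∈ S.face i,
      inner ℝ (φ x - φ (S.lower i)) (φ y - φ (S.lower i)) =
        inner ℝ (x - S.lower i) (y - S.lower i) :=
    fun x hx y hy => inner_map_sub_map (hφ.isometric i hi hin) h0 hx hy
  rw [hin' _ h2 _ h2, hin' _ h1 _ h1, hin' _ h2 _ h1, hS.lower_eq hi hin, hS.lower_succ_eq hi hin,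
    hS.upper_eq hi hin]
  simp only [pt_sub, inner_pt]
  refine ⟨?_, ?_, ?_⟩ <;> ring

/-- In the frame given by the common image `E` of the ladder edges, the boundary edges have the
coordinates `along` and `± across`; the sign is the same for all of them because consecutive
quadrilaterals are on opposite sides of their ladder edge. -/
lemma exists_sign (hS : IsCylinderStrip S f y₀ b h a) (hφ : IsUnfolding S φ) :
    ∃ E : ℂ, E ≠ 0 ∧ (∀ i, 1 ≤ i → i < S.n → φ (S.upper i) - φ (S.lower i) = E) ∧
      ∃ σ : ℝ, (σ = 1 ∨ σ = -1) ∧ ∀ i, 1 ≤ i → i < S.n →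
        φ (S.lower (i + 1)) - φ (S.lower i) =
          E * (along b (a i) + (σ * across b (a i) : ℝ) * Complex.I) := by
  rcases Nat.lt_or_ge 1 S.n with hn | hn
  · refine ⟨φ (S.upper 1) - φ (S.lower 1), ?_, fun i hi hin => hS.ladder_const hφ hi hin.le, ?_⟩
    · intro h0
      have h1 := (hS.gram hφ le_rfl hn).1
      rw [h0, inner_zero_left] at h1
      nlinarith [sq_nonneg b]
    · have hex : ∀ i, 1 ≤ i → i < S.n → ∃ σ : ℝ, (σ = 1 ∨ σ = -1) ∧
          φ (S.lower (i + 1)) - φ (S.lower i) = (φ (S.upper 1) - φ (S.lower 1)) *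
            (along b (a i) + (σ * across b (a i) : ℝ) * Complex.I) := by
        intro i hi hin
        obtain ⟨g1, g2, g3⟩ := hS.gram hφ hi hin
        rw [hS.ladder_const hφ hi hin.le] at g1 g3
        exact exists_sign_of_gram g1 g2 g3
      obtain ⟨σ, hσ, h1⟩ := hex 1 le_rfl hn
      refine ⟨σ, hσ, fun i hi => ?_⟩
      induction i, hi using Nat.le_induction with
      | base => exact fun _ => h1
      | succ k hk ih =>
        intro hkn
        have hprev := ih (by omega)
        obtain ⟨τ, hτ, hnext⟩ := hex (k + 1) (by omega) hkn
        rcases eq_or_ne τ σ with rfl | hne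
        · exact hnext
        exfalso
        have hτσ : τ = -σ := by
          rcases hσ with rfl | rfl <;> rcases hτ with rfl | rfl <;> simp_all
        have hE := hS.ladder_const hφ (by omega : 1 ≤ k + 1) hkn.le
        obtain ⟨z, hz, r, hr, hrz⟩ :=
          AffineSubspace.wOppSide_iff_exists_wbtw.1 (hφ.opposite k hk hkn).1
        have hE0 : φ (S.upper (k + 1)) ≠ φ (S.lower (k + 1)) := by
          intro h0
          have h1 := (hS.gram hφ (by omega : 1 ≤ k + 1) hkn).1
          rw [h0, sub_self, inner_zero_left] at h1
          nlinarith [sq_nonneg b]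
        rw [mem_line_iff_im_eq_zero hE0, hE] at hz
        rw [hE.symm] at hprev hnext hz
        have hE0' := sub_ne_zero.2 hE0
        -- With opposite signs both neighbouring vertices would be on the same side of the ladder.
        have hz' : (z - φ (S.lower (k + 1))) / (φ (S.upper (k + 1)) - φ (S.lower (k + 1))) =
            (((r - 1) * along b (a k) + r * along b (a (k + 1)) : ℝ) : ℂ) +
            ((-σ * ((1 - r) * across b (a k) + r * across b (a (k + 1))) : ℝ) : ℂ) *
              Complex.I := by
          rw [div_eq_iff hE0', ← hrz, AffineMap.lineMap_apply, vsub_eq_sub, vadd_eq_add,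
            Complex.real_smul]
          rw [hτσ] at hnext
          push_cast at hnext hprev ⊢
          linear_combination (r - 1) * hprev + r * hnext
        rw [hz'] at hz
        simp only [Complex.add_im, Complex.ofReal_im, Complex.im_ofReal_mul, Complex.I_im,
          zero_add, mul_one] at hz
        have hpos : 0 < (1 - r) * across b (a k) + r * across b (a (k + 1)) := by
          have p1 := across_pos b (a k)
          have p2 := across_pos b (a (k + 1))
          rcases hr.1.eq_or_lt with h0 | h0
          · rw [← h0]
            linarith
          · have := mul_nonneg (sub_nonneg.2 hr.2) p1.le
            have := mul_pos h0 p2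
            linarith
        rcases hσ with rfl | rfl <;> linarith
  · exact ⟨1, one_ne_zero, fun i _ _ => by omega, 1, Or.inl rfl, fun i _ _ => by omega⟩

lemma upper_edge (hS : IsCylinderStrip S f y₀ b h a) (hφ : IsUnfolding S φ) {i : ℕ} (hi : 1 ≤ i)
    (hin : i < S.n) :
    φ (S.upper (i + 1)) - φ (S.upper i) = φ (S.lower (i + 1)) - φ (S.lower i) := by
  have h1 := hS.ladder_const hφ hi hin.le
  have h2 := hS.ladder_const hφ (by omega : 1 ≤ i + 1) hin
  linear_combination h2 - h1

/-- Both unfolded boundary chains are graphs with monotone slopes over the axis orthogonal to the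
ladder edges. -/
lemma exists_isMonotoneSlopeChain (hS : IsCylinderStrip S f y₀ b h a) (hφ : IsUnfolding S φ) :
    ∃ (E : ℂ) (σ κ : ℝ), (σ = 1 ∨ σ = -1) ∧
      (∀ i, 1 ≤ i → i < S.n → φ (S.upper i) - φ (S.lower i) = E) ∧
      IsMonotoneSlopeChain S.n (fun i => φ (S.lower i)) (E * σ) κ
        (fun i => σ * along b (a i)) (fun i => across b (a i)) ∧
      IsMonotoneSlopeChain S.n (fun i => φ (S.upper i)) (E * σ) κ
        (fun i => σ * along b (a i)) (fun i => across b (a i)) := by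
  obtain ⟨E, hE, hlad, σ, hσ, hedge⟩ := hS.exists_sign hφ
  obtain ⟨κ, hκ, hslope⟩ := exists_sign_along_across b
  have hσ0 : σ ≠ 0 := by rcases hσ with rfl | rfl <;> norm_num
  have hσσ : σ * σ = 1 := by rcases hσ with rfl | rfl <;> norm_num
  have hσσ' : (σ : ℂ) * σ = 1 := by exact_mod_cast hσσ
  have hlow : IsMonotoneSlopeChain S.n (fun i => φ (S.lower i)) (E * σ) (κ * σ)
      (fun i => σ * along b (a i)) (fun i => across b (a i)) := by
    refine ⟨mul_ne_zero hE (by exact_mod_cast hσ0), mul_ne_zero hκ hσ0, ?_,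
      fun i _ _ => across_pos _ _, ?_⟩
    · intro i hi hin
      rw [hedge i hi hin]
      push_cast
      linear_combination (-E * along b (a i)) * hσσ'
    · intro i j hi hij hj
      have h1 := hslope _ _ (hS.slope_antitone hi hij hj)
      linear_combination h1 - (κ * (along b (a i) * across b (a j) -
        along b (a j) * across b (a i))) * hσσ
  refine ⟨E, σ, κ * σ, hσ, hlad, hlow, hlow.frame_ne, hlow.sign_ne, ?_, hlow.pos, hlow.slope⟩
  intro i hi hin
  rw [hS.upper_edge hφ hi hin, ← hlow.edge i hi hin]

/-- The unfolding does not overlap: the coordinate orthogonal to the ladder edges separates the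
images of different quadrilaterals, except along common ladder edges. -/
lemma injOn (hS : IsCylinderStrip S f y₀ b h a) (hφ : IsUnfolding S φ) : InjOn φ S.surface := by
  obtain ⟨E, σ, κ, -, hlad, hch, -⟩ := hS.exists_isMonotoneSlopeChain hφ
  have same : ∀ i, 1 ≤ i → i < S.n → ∀ p ∈ S.face i, ∀ q ∈ S.face i, φ p = φ q → p = q := by
    intro i hi hin p hp q hq hpq
    rw [← dist_eq_zero, ← hφ.isometric i hi hin p hp q hq, hpq, dist_self]
  have him : ∀ i, 1 ≤ i → i < S.n → ∀ s ∈ Icc (0 : ℝ) 1, ∀ t ∈ Icc (0 : ℝ) 1,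
      (φ (pt f (i + s) (y₀ + t) (h i + s * a i + t * b)) / (E * σ)).im =
        (φ (S.lower i) / (E * σ)).im + s * across b (a i) := by
    intro i hi hin s hs t ht
    have hE : E ≠ 0 := left_ne_zero_of_mul hch.frame_ne
    have hlast : (t * E / (E * σ)) = ((t / σ : ℝ) : ℂ) := by
      push_cast
      rw [mul_comm E, mul_div_mul_right _ _ hE]
    rw [hS.map_face hφ hi hin hs ht, hlad i hi hin, add_div, Complex.add_im,
      hch.im_edge_point hi hin, hlast, Complex.ofReal_im, add_zero]
  have main : ∀ i j, 1 ≤ i → i ≤ j → j < S.n → ∀ p ∈ S.face i, ∀ q ∈ S.face j,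
      φ p = φ q → p = q := by
    intro i j hi hij hj p hp q hq hpq
    rcases hij.eq_or_lt with rfl | hlt
    · exact same i hi hj p hp q hq hpq
    have hfi := hp
    have hfj := hq
    rw [hS.face i hi (by omega)] at hp
    rw [hS.face j (by omega) hj] at hq
    obtain ⟨s, hs, t, ht, rfl⟩ := hp
    obtain ⟨s', hs', t', ht', rfl⟩ := hq
    have e1 := him i hi (by omega) s hs t ht
    have e2 := him j (by omega) hj s' hs' t' ht'
    rw [hpq, e2] at e1
    have e3 := hch.im_vertex_succ hi (by omega : i < S.n)
    have p1 := across_pos b (a i)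
    have p2 := across_pos b (a j)
    have hs'0 : 0 ≤ s' * across b (a j) := mul_nonneg hs'.1 p2.le
    rcases (Nat.succ_le_of_lt hlt).eq_or_lt with heq | hlt'
    · have hj1 : j = i + 1 := heq.symm
      subst hj1
      have hs1 : s = 1 := by
        refine le_antisymm hs.2 ?_
        nlinarith
      -- The point is on the common ladder edge of the two quadrilaterals.
      refine same (i + 1) (by omega) hj _ ?_ _ hfj hpq
      rw [hS.face (i + 1) (by omega) hj]
      refine ⟨0, by simp, t, ht, ?_⟩
      rw [hs1, hS.step]
      push_cast
      simp
    · exfalso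
      have e4 := hch.im_vertex_lt (by omega : 1 ≤ i + 1) hlt' hj.le
      nlinarith [hs.2]
  rintro p ⟨i, hi, hin, hp⟩ q ⟨j, hj, hjn, hq⟩ hpq
  rcases le_total i j with hij | hij
  · exact main i j hi hij hjn p hp q hq hpq
  · exact (main j i hj hij hin q hq p hp hpq.symm).symm

lemma disjoint_chainCurve (hS : IsCylinderStrip S f y₀ b h a) (hφ : IsUnfolding S φ) :
    Disjoint (chainCurve S.n fun i => φ (S.lower i)) (chainCurve S.n fun i => φ (S.upper i)) := by
  rw [Set.disjoint_left]
  rintro z ⟨i, hi, hin, hz⟩ ⟨j, hj, hjn, hz'⟩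
  obtain ⟨s, hs, rfl⟩ := mem_segment_iff_add_smul_sub.1 hz
  obtain ⟨t, ht, hst⟩ := mem_segment_iff_add_smul_sub.1 hz'
  have m0 : (0 : ℝ) ∈ Icc (0 : ℝ) 1 := by simp
  have m1 : (1 : ℝ) ∈ Icc (0 : ℝ) 1 := by simp
  have e1 := hS.map_face hφ hi hin hs m0
  have e2 := hS.map_face hφ hj hjn ht m1
  have e3 := hS.upper_edge hφ hj hjn
  have heq := hS.injOn hφ ⟨i, hi, hin, hS.mem_face hi hin hs m0⟩
    ⟨j, hj, hjn, hS.mem_face hj hjn ht m1⟩ (by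
      rw [e1, e2]
      push_cast
      linear_combination hst + t * e3)
  have := congrArg (inner ℝ (f 1)) heq
  rw [pt_coord_one, pt_coord_one] at this
  linarith

end Unfolding

end IsCylinderStrip

/-! ### Turn angles -/

lemma quadTurn_eq_angle_sub_angle (p q : ℕ → Space) (i : ℕ) :
    quadTurn p q i =
      InnerProductGeometry.angle (q (i + 1) - p (i + 1)) (p (i + 2) - p (i + 1)) -
        InnerProductGeometry.angle (q (i + 1) - p (i + 1)) (p (i + 1) - p i) := by
  rw [quadTurn, EuclideanGeometry.angle, EuclideanGeometry.angle, vsub_eq_sub, vsub_eq_sub,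
    vsub_eq_sub, ← neg_sub (p (i + 1)) (p i), InnerProductGeometry.angle_neg_left,
    InnerProductGeometry.angle_comm (p (i + 1) - p i)]
  ring

lemma spaceTurn_eq_angle (p : ℕ → Space) (i : ℕ) :
    spaceTurn p i = InnerProductGeometry.angle (p (i + 1) - p i) (p (i + 2) - p (i + 1)) := by
  rw [spaceTurn, EuclideanGeometry.angle, vsub_eq_sub, vsub_eq_sub, ← neg_sub (p (i + 1)) (p i),
    InnerProductGeometry.angle_neg_left]
  ring

/-- The triangle inequality for the three directions at a vertex of a boundary chain. -/
lemma abs_quadTurn_le_spaceTurn (p q : ℕ → Space) (i : ℕ) : |quadTurn p q i| ≤ spaceTurn p i := by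
  rw [quadTurn_eq_angle_sub_angle, spaceTurn_eq_angle, abs_le]
  have h1 := InnerProductGeometry.angle_le_angle_add_angle (q (i + 1) - p (i + 1))
    (p (i + 1) - p i) (p (i + 2) - p (i + 1))
  have h2 := InnerProductGeometry.angle_le_angle_add_angle (q (i + 1) - p (i + 1))
    (p (i + 2) - p (i + 1)) (p (i + 1) - p i)
  rw [InnerProductGeometry.angle_comm (p (i + 2) - p (i + 1))] at h2
  constructor <;> linarith

namespace IsCylinderStrip

variable {S : QuadStrip} {f : OrthonormalBasis (Fin 3) ℝ Space} {y₀ b : ℝ} {h a : ℕ → ℝ}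

lemma lower_sub (hS : IsCylinderStrip S f y₀ b h a) {i : ℕ} (hi : 1 ≤ i) (hin : i < S.n) :
    S.lower (i + 1) - S.lower i = pt f 1 0 (a i) := by
  rw [hS.lower_eq hi hin, hS.lower_succ_eq hi hin, pt_sub]
  congr 1 <;> ring

lemma upper_sub (hS : IsCylinderStrip S f y₀ b h a) {i : ℕ} (hi : 1 ≤ i) (hin : i < S.n) :
    S.upper (i + 1) - S.upper i = pt f 1 0 (a i) := by
  rw [hS.upper_eq hi hin, hS.upper_succ_eq hi hin, pt_sub]
  congr 1 <;> ring

lemma upper_sub_lower (hS : IsCylinderStrip S f y₀ b h a) {i : ℕ} (hi : 1 ≤ i) (hin : i ≤ S.n) :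
    S.upper i - S.lower i = pt f 0 1 b := by
  rw [hS.upper i hi hin, hS.lower i hi hin, pt_sub]
  congr 1 <;> ring

lemma quadTurn_lower (hS : IsCylinderStrip S f y₀ b h a) {i : ℕ} (hi : 1 ≤ i)
    (hin : i + 2 ≤ S.n) : quadTurn S.lower S.upper i =
      Complex.arg (along b (a (i + 1)) + across b (a (i + 1)) * Complex.I) -
        Complex.arg (along b (a i) + across b (a i) * Complex.I) := by
  rw [quadTurn_eq_angle_sub_angle, hS.upper_sub_lower (by omega) (by omega),
    hS.lower_sub hi (by omega), hS.lower_sub (by omega : 1 ≤ i + 1) (by omega),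
    angle_ladder_edge, angle_ladder_edge]

lemma quadTurn_upper (hS : IsCylinderStrip S f y₀ b h a) {i : ℕ} (hi : 1 ≤ i)
    (hin : i + 2 ≤ S.n) : quadTurn S.upper S.lower i = -quadTurn S.lower S.upper i := by
  rw [quadTurn_eq_angle_sub_angle, quadTurn_eq_angle_sub_angle, ← neg_sub (S.upper (i + 1)),
    hS.lower_sub hi (by omega), hS.lower_sub (by omega : 1 ≤ i + 1) (by omega),
    hS.upper_sub hi (by omega), hS.upper_sub (by omega : 1 ≤ i + 1) (by omega),
    InnerProductGeometry.angle_neg_left, InnerProductGeometry.angle_neg_left]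
  ring

end IsCylinderStrip

/-! ### The boundary chains of the cap -/

/-- The chain `(i, h i)` in the plane. -/
noncomputable def graphChain (h : ℕ → ℝ) (i : ℕ) : ℂ := i + h i * Complex.I

lemma graphChain_sub (h : ℕ → ℝ) (i : ℕ) :
    graphChain h (i + 1) - graphChain h i = 1 + (h (i + 1) - h i : ℝ) * Complex.I := by
  simp only [graphChain]
  push_cast
  ring

lemma graphChain_isMonotoneSlopeChain {n : ℕ} {h : ℕ → ℝ}
    (hconc : ∀ i j, 1 ≤ i → i ≤ j → j < n → h (j + 1) - h j ≤ h (i + 1) - h i) :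
    IsMonotoneSlopeChain n (graphChain h) (-Complex.I) (-1) (fun i => -(h (i + 1) - h i))
      (fun _ => 1) := by
  refine ⟨neg_ne_zero.2 Complex.I_ne_zero, by norm_num, ?_, fun _ _ _ => one_pos, ?_⟩
  · intro i _ _
    rw [graphChain_sub]
    push_cast
    linear_combination Complex.I_mul_I
  · intro i j hi hij hj
    linarith [hconc i j hi hij hj]

/-- A chain in space that is the graph of `h` over equally spaced points of a line has the
same vertex distances as the chain `(i, h i)`. -/
lemma isPlanarCopy_graphChain {f : OrthonormalBasis (Fin 3) ℝ Space} {n : ℕ} {p : ℕ → Space}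
    {y : ℝ} {h : ℕ → ℝ}
    (hp : ∀ i, 1 ≤ i → i ≤ n → p i = pt f i y (h i)) : IsPlanarCopy n p (graphChain h) := by
  intro i j hi hin hj hjn
  have key : graphChain h i - graphChain h j =
      ((i - j : ℝ) : ℂ) + ((h i - h j : ℝ) : ℂ) * Complex.I := by
    simp only [graphChain]
    push_cast
    ring
  rw [dist_eq_norm, dist_eq_norm, hp i hi hin, hp j hj hjn, pt_sub, norm_pt, key,
    Complex.norm_add_mul_I]
  ring_nf

/-- The angles of a chain are determined by the distances of its vertices. -/
lemma abs_turnAngle_of_isPlanarCopy {n : ℕ} {p : ℕ → Space} {c : ℕ → ℂ} (hc : IsPlanarCopy n p c)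
    (hne : ∀ i, 1 ≤ i → i < n → c i ≠ c (i + 1)) {i : ℕ} (hi : 1 ≤ i) (hin : i + 2 ≤ n) :
    |turnAngle c i| = spaceTurn p i := by
  have d1 := hc i (i + 1) hi (by omega) (by omega) (by omega)
  have d2 := hc (i + 1) (i + 2) (by omega) (by omega) (by omega) (by omega)
  have d3 := hc i (i + 2) hi (by omega) (by omega) (by omega)
  rw [turnAngle, ← Complex.angle_eq_abs_arg
    (sub_ne_zero.2 (hne (i + 1) (by omega) (by omega)).symm)
    (sub_ne_zero.2 (hne i hi (by omega)).symm), InnerProductGeometry.angle_comm,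
    spaceTurn_eq_angle, InnerProductGeometry.angle, InnerProductGeometry.angle,
    real_inner_eq_norm_add_mul_self_sub_norm_mul_self_sub_norm_mul_self_div_two,
    real_inner_eq_norm_add_mul_self_sub_norm_mul_self_sub_norm_mul_self_div_two]
  rw [dist_comm, dist_eq_norm, dist_comm, dist_eq_norm] at d1 d2 d3
  rw [add_comm, sub_add_sub_cancel, add_comm (p (i + 1) - p i), sub_add_sub_cancel, d1, d2, d3]

/-- A planar chain with the edge lengths of a concave graph, and with turn angles bounded by those
of this graph, is a valid straightening of it. -/
lemma exists_isValidStraightening {f : OrthonormalBasis (Fin 3) ℝ Space} {n : ℕ} {p : ℕ → Space}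
    {u : ℕ → ℂ} {y : ℝ} {h : ℕ → ℝ}
    (hconc : ∀ i j, 1 ≤ i → i ≤ j → j < n → h (j + 1) - h j ≤ h (i + 1) - h i)
    (hp : ∀ i, 1 ≤ i → i ≤ n → p i = pt f i y (h i))
    (hlen : ∀ i, 1 ≤ i → i < n → dist (u i) (u (i + 1)) = dist (p i) (p (i + 1)))
    (hturn : ∀ i, 1 ≤ i → i + 2 ≤ n → turnAngle u i ∈ Icc (-spaceTurn p i) (spaceTurn p i)) :
    ∃ c : ℕ → ℂ, IsPlanarCopy n p c ∧ IsValidStraightening n c u := by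
  have hch := graphChain_isMonotoneSlopeChain hconc
  have hcopy := isPlanarCopy_graphChain hp
  refine ⟨graphChain h, hcopy, hch.isConvexChain, ?_, ?_⟩
  · intro i hi hin
    rw [hlen i hi hin, hcopy i (i + 1) hi hin.le (by omega) hin]
  · intro i hi hin
    rw [abs_turnAngle_of_isPlanarCopy hcopy hch.isSimpleChain.1 hi hin]
    exact hturn i hi hin

/-! ### Existence of an unfolding -/

/-- The image of the `k`-th boundary edge when the strip is unrolled with its ladder edges
parallel to the positive real axis. -/
noncomputable def unrolledEdge (b : ℝ) (a : ℕ → ℝ) (k : ℕ) : ℂ :=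
  √(1 + b ^ 2) * (along b (a k) + across b (a k) * Complex.I)

/-- The unrolling of a cylindrical strip: the point over `(x, y)` goes to the point at parameter
`x` of the unrolled lower boundary chain, shifted along the ladder direction by `y - y₀` times the
length of a ladder edge. -/
noncomputable def unroll (f : OrthonormalBasis (Fin 3) ℝ Space) (y₀ b : ℝ) (a : ℕ → ℝ)
    (p : Space) : ℂ :=
  ∑ k ∈ Finset.range ⌊inner ℝ (f 0) p⌋₊, unrolledEdge b a k +
    (inner ℝ (f 0) p - ⌊inner ℝ (f 0) p⌋₊ : ℝ) * unrolledEdge b a ⌊inner ℝ (f 0) p⌋₊ +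
    (inner ℝ (f 1) p - y₀ : ℝ) * (√(1 + b ^ 2) : ℝ)

lemma unroll_vertex (f : OrthonormalBasis (Fin 3) ℝ Space) (y₀ b : ℝ) (a : ℕ → ℝ) (i : ℕ)
    (y z : ℝ) : unroll f y₀ b a (pt f i y z) =
      ∑ k ∈ Finset.range i, unrolledEdge b a k + (y - y₀ : ℝ) * (√(1 + b ^ 2) : ℝ) := by
  simp [unroll, pt_coord_zero, pt_coord_one]

lemma unroll_face (f : OrthonormalBasis (Fin 3) ℝ Space) (y₀ b : ℝ) (a : ℕ → ℝ) (i : ℕ) {s : ℝ}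
    (hs : s ∈ Icc (0 : ℝ) 1) (y z : ℝ) : unroll f y₀ b a (pt f (i + s) y z) =
      ∑ k ∈ Finset.range i, unrolledEdge b a k + s * unrolledEdge b a i +
        (y - y₀ : ℝ) * (√(1 + b ^ 2) : ℝ) := by
  rcases hs.2.eq_or_lt with rfl | hlt
  · have h1 := unroll_vertex f y₀ b a (i + 1) y z
    rw [Finset.sum_range_succ] at h1
    push_cast at h1 ⊢
    rw [h1, one_mul]
  · have hfl : ⌊(i : ℝ) + s⌋₊ = i := by
      rw [Nat.floor_eq_iff (by have := hs.1; positivity)]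
      constructor <;> linarith [hs.1]
    simp [unroll, pt_coord_zero, pt_coord_one, hfl]

lemma norm_unrolled (f : OrthonormalBasis (Fin 3) ℝ Space) (b : ℝ) (a : ℕ → ℝ) (i : ℕ) (s t : ℝ) :
    ‖(s : ℂ) * unrolledEdge b a i + (t : ℂ) * (√(1 + b ^ 2) : ℝ)‖ =
      ‖pt f s t (s * a i + t * b)‖ := by
  have hb : (0 : ℝ) < 1 + b ^ 2 := by positivity
  have key : (s : ℂ) * unrolledEdge b a i + (t : ℂ) * (√(1 + b ^ 2) : ℝ) =
      ((√(1 + b ^ 2) * (s * along b (a i) + t) : ℝ) : ℂ) +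
        ((√(1 + b ^ 2) * (s * across b (a i)) : ℝ) : ℂ) * Complex.I := by
    simp only [unrolledEdge]
    push_cast
    ring
  have h1 := along_sq_add_across_sq b (a i)
  rw [eq_div_iff hb.ne'] at h1
  have h2 : along b (a i) * (1 + b ^ 2) = a i * b := by
    rw [along]
    field_simp
  rw [key, Complex.norm_add_mul_I, norm_pt, mul_pow, mul_pow, Real.sq_sqrt hb.le]
  congr 1
  linear_combination s ^ 2 * h1 + 2 * s * t * h2

namespace IsCylinderStrip

variable {S : QuadStrip} {f : OrthonormalBasis (Fin 3) ℝ Space} {y₀ b : ℝ} {h a : ℕ → ℝ}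

theorem isUnfolding_unroll (hS : IsCylinderStrip S f y₀ b h a) :
    IsUnfolding S (unroll f y₀ b a) := by
  constructor
  · intro i hi hin p hp q hq
    rw [hS.face i hi hin] at hp hq
    obtain ⟨s, hs, t, ht, rfl⟩ := hp
    obtain ⟨s', hs', t', ht', rfl⟩ := hq
    rw [dist_eq_norm, dist_eq_norm, unroll_face _ _ _ _ _ hs, unroll_face _ _ _ _ _ hs', pt_sub]
    have hpt : pt f (i + s - (i + s')) (y₀ + t - (y₀ + t'))
        (h i + s * a i + t * b - (h i + s' * a i + t' * b)) =
        pt f (s - s') (t - t') ((s - s') * a i + (t - t') * b) := by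
      congr 1 <;> ring
    rw [hpt, ← norm_unrolled]
    congr 1
    push_cast
    ring
  · intro i hi hin
    have hb : (0 : ℝ) < √(1 + b ^ 2) := by positivity
    have hL : ((√(1 + b ^ 2) : ℝ) : ℂ) ≠ 0 := by exact_mod_cast hb.ne'
    rw [hS.lower i hi (by omega), hS.lower (i + 1) (by omega) (by omega),
      hS.lower (i + 2) (by omega) hin, hS.upper (i + 1) (by omega) (by omega),
      unroll_vertex, unroll_vertex, unroll_vertex, unroll_vertex, Finset.sum_range_succ _ (i + 1),
      Finset.sum_range_succ _ i]
    generalize ∑ k ∈ Finset.range i, unrolledEdge b a k = U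
    have hlad : U + unrolledEdge b a i + ((y₀ + 1 - y₀ : ℝ) : ℂ) * (√(1 + b ^ 2) : ℝ) -
        (U + unrolledEdge b a i + ((y₀ - y₀ : ℝ) : ℂ) * (√(1 + b ^ 2) : ℝ)) =
          (√(1 + b ^ 2) : ℝ) := by
      push_cast
      ring
    have p1 := across_pos b (a i)
    have p2 := across_pos b (a (i + 1))
    have hsum : (across b (a i) : ℂ) + across b (a (i + 1)) ≠ 0 := by
      exact_mod_cast (add_pos p1 p2).ne'
    refine ⟨AffineSubspace.wOppSide_iff_exists_wbtw.2 ⟨_, ?_,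
      across b (a i) / (across b (a i) + across b (a (i + 1))), ⟨by positivity, ?_⟩, rfl⟩, ?_, ?_⟩
    · rw [mem_line_iff_im_eq_zero (by rw [← sub_ne_zero, hlad]; exact hL), hlad]
      -- The segment between the neighbouring vertices crosses the line of the ladder edge, at a
      -- parameter given by the ratio of their distances from it.
      have : (AffineMap.lineMap (U + ((y₀ - y₀ : ℝ) : ℂ) * (√(1 + b ^ 2) : ℝ))
            (U + unrolledEdge b a i + unrolledEdge b a (i + 1) +
              ((y₀ - y₀ : ℝ) : ℂ) * (√(1 + b ^ 2) : ℝ))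
            (across b (a i) / (across b (a i) + across b (a (i + 1)))) -
          (U + unrolledEdge b a i + ((y₀ - y₀ : ℝ) : ℂ) * (√(1 + b ^ 2) : ℝ))) /
            (√(1 + b ^ 2) : ℝ) =
          ((across b (a i) * (along b (a i) + along b (a (i + 1))) /
            (across b (a i) + across b (a (i + 1))) - along b (a i) : ℝ) : ℂ) := by
        rw [AffineMap.lineMap_apply, vsub_eq_sub, vadd_eq_add, Complex.real_smul]
        simp only [unrolledEdge]
        push_cast
        field_simp
        ring
      rw [this, Complex.ofReal_im]
    · rw [div_le_one (by positivity)]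
      linarith
    · rw [mem_line_iff_im_eq_zero (by rw [← sub_ne_zero, hlad]; exact hL), hlad]
      have : (U + ((y₀ - y₀ : ℝ) : ℂ) * (√(1 + b ^ 2) : ℝ) -
          (U + unrolledEdge b a i + ((y₀ - y₀ : ℝ) : ℂ) * (√(1 + b ^ 2) : ℝ))) /
            (√(1 + b ^ 2) : ℝ) =
          ((-along b (a i) : ℝ) : ℂ) + ((-across b (a i) : ℝ) : ℂ) * Complex.I := by
        simp only [unrolledEdge]
        push_cast
        field_simp
        ring
      rw [this]
      simpa using p1.ne'
    · rw [mem_line_iff_im_eq_zero (by rw [← sub_ne_zero, hlad]; exact hL), hlad]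
      have : (U + unrolledEdge b a i + unrolledEdge b a (i + 1) +
            ((y₀ - y₀ : ℝ) : ℂ) * (√(1 + b ^ 2) : ℝ) -
          (U + unrolledEdge b a i + ((y₀ - y₀ : ℝ) : ℂ) * (√(1 + b ^ 2) : ℝ))) /
            (√(1 + b ^ 2) : ℝ) =
          ((along b (a (i + 1)) : ℝ) : ℂ) + ((across b (a (i + 1)) : ℝ) : ℂ) * Complex.I := by
        simp only [unrolledEdge]
        push_cast
        field_simp
        ring
      rw [this]
      simpa using p2.ne'

end IsCylinderStrip

/-! ### The strips of a cap are cylindrical -/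

/-- If the pieces of `g` over consecutive unit cells of the strip are affine, then continuity along
the common sides of the cells forces them to have the same slope in the second coordinate. -/
lemma exists_isCylinderStrip_of_affine {S : QuadStrip} {f : OrthonormalBasis (Fin 3) ℝ Space}
    {g : ℝ → ℝ → ℝ} {y₀ : ℝ}
    (hplanar : ∀ i : ℕ, 1 ≤ i → i < S.n → ∃ α β γ : ℝ, ∀ s ∈ Icc (i : ℝ) (i + 1),
      ∀ t ∈ Icc y₀ (y₀ + 1), g s t = α * s + β * t + γ)
    (hconc : ∀ i : ℕ, 1 ≤ i → i + 2 ≤ S.n →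
      g i y₀ + g (i + 1 + 1 : ℕ) y₀ ≤ 2 * g (i + 1 : ℕ) y₀)
    (hlower : ∀ i, S.lower i = pt f i y₀ (g i y₀))
    (hupper : ∀ i, S.upper i = pt f i (y₀ + 1) (g i (y₀ + 1)))
    (hface : ∀ i, S.face i = {p | ∃ s ∈ Icc (i : ℝ) (i + 1), ∃ t ∈ Icc y₀ (y₀ + 1),
      p = pt f s t (g s t)}) :
    ∃ (b : ℝ) (h a : ℕ → ℝ), IsCylinderStrip S f y₀ b h a := by
  have m0 : y₀ ∈ Icc y₀ (y₀ + 1) := by simp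
  have m1 : y₀ + 1 ∈ Icc y₀ (y₀ + 1) := by simp
  have hladder : ∀ i : ℕ, 1 ≤ i → i ≤ S.n →
      g i (y₀ + 1) = g i y₀ + (g (1 : ℕ) (y₀ + 1) - g (1 : ℕ) y₀) := by
    intro i hi
    induction i, hi using Nat.le_induction with
    | base =>
      intro _
      ring
    | succ k hk ih =>
      intro hkn
      obtain ⟨α, β, γ, hg⟩ := hplanar k hk hkn
      have n0 : (k : ℝ) ∈ Icc (k : ℝ) (k + 1) := by simp
      have n1 : (k : ℝ) + 1 ∈ Icc (k : ℝ) (k + 1) := by simp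
      have e := ih (by omega)
      rw [hg _ n0 _ m0, hg _ n0 _ m1] at e
      rw [Nat.cast_add_one, hg _ n1 _ m0, hg _ n1 _ m1]
      linear_combination e
  refine ⟨g (1 : ℕ) (y₀ + 1) - g (1 : ℕ) y₀, fun i => g i y₀,
    fun i => g (i + 1 : ℕ) y₀ - g i y₀, fun i => by simp, ?_, fun i _ _ => hlower i, ?_, ?_⟩
  · intro i hi hin
    linarith [hconc i hi hin]
  · intro i hi hin
    rw [hupper, hladder i hi hin]
  · intro i hi hin
    obtain ⟨α, β, γ, hg⟩ := hplanar i hi hin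
    have n0 : (i : ℝ) ∈ Icc (i : ℝ) (i + 1) := by simp
    have n1 : (i : ℝ) + 1 ∈ Icc (i : ℝ) (i + 1) := by simp
    have hval : ∀ s ∈ Icc (0 : ℝ) 1, ∀ t ∈ Icc (0 : ℝ) 1, g (i + s) (y₀ + t) =
        g i y₀ + s * (g (i + 1 : ℕ) y₀ - g i y₀) +
          t * (g (1 : ℕ) (y₀ + 1) - g (1 : ℕ) y₀) := by
      intro s hs t ht
      have e := hladder i hi hin.le
      rw [hg _ n0 _ m0, hg _ n0 _ m1] at e
      rw [Nat.cast_add_one, hg _ n0 _ m0, hg _ n1 _ m0,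
        hg (i + s) ⟨by linarith [hs.1], by linarith [hs.2]⟩ (y₀ + t)
          ⟨by linarith [ht.1], by linarith [ht.2]⟩]
      linear_combination t * e
    rw [hface]
    ext p
    constructor
    · rintro ⟨s, hs, t, ht, rfl⟩
      have hs' : s - i ∈ Icc (0 : ℝ) 1 := ⟨by linarith [hs.1], by linarith [hs.2]⟩
      have ht' : t - y₀ ∈ Icc (0 : ℝ) 1 := ⟨by linarith [ht.1], by linarith [ht.2]⟩
      refine ⟨s - i, hs', t - y₀, ht', ?_⟩
      rw [← hval _ hs' _ ht', add_sub_cancel, add_sub_cancel]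
    · rintro ⟨s, hs, t, ht, rfl⟩
      refine ⟨i + s, ⟨by linarith [hs.1], by linarith [hs.2]⟩, y₀ + t,
        ⟨by linarith [ht.1], by linarith [ht.2]⟩, ?_⟩
      rw [hval _ hs _ ht]

lemma pt_basisFun (x y z : ℝ) : pt (EuclideanSpace.basisFun (Fin 3) ℝ) x y z = !₂[x, y, z] := by
  ext k
  fin_cases k <;> simp [pt]

lemma pt_basisFun_swap (x y z : ℝ) :
    pt ((EuclideanSpace.basisFun (Fin 3) ℝ).reindex (Equiv.swap 0 1)) x y z = !₂[y, x, z] := by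
  have h2 : (Equiv.swap (0 : Fin 3) 1) 2 = 2 := by decide
  ext k
  fin_cases k <;> simp [pt, h2]

/-- Concavity at the midpoint of a segment in the base of the cap. -/
lemma LatticeQuadConvexCap.midpoint_le {nx ny : ℕ} (C : LatticeQuadConvexCap nx ny)
    {s t s' t' : ℝ} (hs : s ∈ Icc (1 : ℝ) nx) (ht : t ∈ Icc (1 : ℝ) ny)
    (hs' : s' ∈ Icc (1 : ℝ) nx) (ht' : t' ∈ Icc (1 : ℝ) ny) :
    C.height s t + C.height s' t' ≤ 2 * C.height ((s + s') / 2) ((t + t') / 2) := by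
  have h := C.concave.2 (x := (s, t)) ⟨hs, ht⟩ (y := (s', t')) ⟨hs', ht'⟩
    (by norm_num : (0 : ℝ) ≤ 1 / 2) (by norm_num : (0 : ℝ) ≤ 1 / 2) (by norm_num)
  simp only [Prod.smul_mk, Prod.mk_add_mk, smul_eq_mul] at h
  have e1 : 1 / 2 * s + 1 / 2 * s' = (s + s') / 2 := by ring
  have e2 : 1 / 2 * t + 1 / 2 * t' = (t + t') / 2 := by ring
  rw [e1, e2] at h
  linarith

theorem LatticeQuadConvexCap.IsStrip.exists_isCylinderStrip {nx ny : ℕ}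
    {C : LatticeQuadConvexCap nx ny} {S : QuadStrip} (hS : C.IsStrip S) :
    ∃ (f : OrthonormalBasis (Fin 3) ℝ Space) (y₀ b : ℝ) (h a : ℕ → ℝ),
      IsCylinderStrip S f y₀ b h a := by
  have cast_mem : ∀ i n : ℕ, 1 ≤ i → i ≤ n → (i : ℝ) ∈ Icc (1 : ℝ) n := fun i n h1 h2 =>
    ⟨by exact_mod_cast h1, by exact_mod_cast h2⟩
  have mid : ∀ i : ℕ, ((i : ℝ) + (i + 1 + 1 : ℕ)) / 2 = (i + 1 : ℕ) := by
    intro i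
    push_cast
    ring
  rcases hS with ⟨y, hy, hyn, rfl⟩ | ⟨x, hx, hxn, rfl⟩
  · refine ⟨EuclideanSpace.basisFun (Fin 3) ℝ, y, exists_isCylinderStrip_of_affine (g := C.height)
      (fun i hi hin => C.planar i y hi hin hy hyn) ?_ (fun i => ?_) (fun i => ?_) (fun i => ?_)⟩
    · intro i hi hin
      have hin' : i + 2 ≤ nx := hin
      have key := C.midpoint_le (cast_mem i nx hi (by omega)) (cast_mem y ny hy hyn.le)
        (cast_mem (i + 1 + 1) nx (by omega) hin') (cast_mem y ny hy hyn.le)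
      rwa [mid, add_self_div_two] at key
    · rw [pt_basisFun]; rfl
    · rw [pt_basisFun]; rfl
    · simp only [pt_basisFun]; rfl
  · refine ⟨(EuclideanSpace.basisFun (Fin 3) ℝ).reindex (Equiv.swap 0 1), x,
      exists_isCylinderStrip_of_affine (g := fun s t => C.height t s)
      (fun j hj hjn => ?_) ?_ (fun i => ?_) (fun i => ?_) (fun i => ?_)⟩
    · obtain ⟨α, β, γ, hg⟩ := C.planar x j hx hxn hj hjn
      refine ⟨β, α, γ, fun s hs t ht => ?_⟩
      rw [hg t ht s hs]
      ring
    · intro i hi hin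
      have hin' : i + 2 ≤ ny := hin
      have key := C.midpoint_le (cast_mem x nx hx hxn.le) (cast_mem i ny hi (by omega))
        (cast_mem x nx hx hxn.le) (cast_mem (i + 1 + 1) ny (by omega) hin')
      rwa [mid, add_self_div_two] at key
    · rw [pt_basisFun_swap]; rfl
    · rw [pt_basisFun_swap]; rfl
    · simp only [pt_basisFun_swap]
      ext p
      constructor
      · rintro ⟨s, hs, t, ht, rfl⟩
        exact ⟨t, ht, s, hs, rfl⟩
      · rintro ⟨s, hs, t, ht, rfl⟩
        exact ⟨t, ht, s, hs, rfl⟩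

/-! ### Strip unfolding -/

open scoped Affine in
theorem mainTheorem3 {nx ny : ℕ} (C : LatticeQuadConvexCap nx ny) (S : QuadStrip)
    (hS : C.IsStrip S) :
    -- the strip can be unfolded, and for every unfolding, with boundary curves `u` and `w`:
    (∃ φ : Space → ℂ, IsUnfolding S φ) ∧
    ∀ φ : Space → ℂ, IsUnfolding S φ →
      ∀ u w : ℕ → ℂ, (∀ i, u i = φ (S.lower i)) → (∀ i, w i = φ (S.upper i)) →
        -- no self-overlap
        InjOn φ S.surface ∧
        -- the two boundary curves are convex
        IsConvexChain S.n u ∧ IsConvexChain S.n w ∧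
        -- up to the orientation of the unfolding and the side of the strip, the turn angles are
        -- the sums of the two incident quadrilateral angles, minus `π`
        (∃ ε : ℝ, (ε = 1 ∨ ε = -1) ∧ ∀ i, 1 ≤ i → i + 2 ≤ S.n →
          turnAngle u i = ε * quadTurn S.lower S.upper i ∧
          turnAngle w i = -ε * quadTurn S.upper S.lower i) ∧
        -- the turn angles lie in `[-τ₀, τ₀]`
        (∀ i, 1 ≤ i → i + 2 ≤ S.n →
          turnAngle u i ∈ Icc (-spaceTurn S.lower i) (spaceTurn S.lower i) ∧
          turnAngle w i ∈ Icc (-spaceTurn S.upper i) (spaceTurn S.upper i)) ∧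
        -- the turn angles all have the same sign
        ((∀ i, 1 ≤ i → i + 2 ≤ S.n → 0 ≤ turnAngle u i ∧ 0 ≤ turnAngle w i) ∨
          (∀ i, 1 ≤ i → i + 2 ≤ S.n → turnAngle u i ≤ 0 ∧ turnAngle w i ≤ 0)) ∧
        -- each boundary curve is a valid straightening of the corresponding chain of the cap,
        -- which is convex
        (∃ c : ℕ → ℂ, IsPlanarCopy S.n S.lower c ∧ IsValidStraightening S.n c u) ∧
        (∃ c : ℕ → ℂ, IsPlanarCopy S.n S.upper c ∧ IsValidStraightening S.n c w) ∧
        -- the boundary curves are simple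
        IsSimpleChain S.n u ∧ IsSimpleChain S.n w ∧
        -- the ladder edges are parallel, and the boundary curves are disjoint
        (∀ i j, 1 ≤ i → i ≤ S.n → 1 ≤ j → j ≤ S.n → line[ℝ, u i, w i] ∥ line[ℝ, u j, w j]) ∧
        Disjoint (chainCurve S.n u) (chainCurve S.n w) := by
  obtain ⟨f, y₀, b, h, a, hcyl⟩ := hS.exists_isCylinderStrip
  refine ⟨⟨_, hcyl.isUnfolding_unroll⟩, fun φ hφ u w hu hw => ?_⟩
  obtain rfl : u = fun i => φ (S.lower i) := funext hu
  obtain rfl : w = fun i => φ (S.upper i) := funext hw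
  obtain ⟨E, σ, κ, hσ, -, hlow, hup⟩ := hcyl.exists_isMonotoneSlopeChain hφ
  have hquad : ∀ {v : ℕ → ℂ}, IsMonotoneSlopeChain S.n v (E * σ) κ
      (fun i => σ * along b (a i)) (fun i => across b (a i)) →
      ∀ i, 1 ≤ i → i + 2 ≤ S.n → turnAngle v i = σ * quadTurn S.lower S.upper i := by
    intro v hv i hi hin
    rw [turnAngle, hv.edge_div hi (by omega) (by omega : 1 ≤ i + 1) (by omega),
      arg_div_sign hσ _ _ (across_pos _ _) (across_pos _ _), hcyl.quadTurn_lower hi hin]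
  have habs : ∀ r : ℝ, |σ * r| = |r| := by
    intro r
    rcases hσ with rfl | rfl <;> simp
  have hturn_low : ∀ i, 1 ≤ i → i + 2 ≤ S.n →
      turnAngle (fun i => φ (S.lower i)) i ∈
        Icc (-spaceTurn S.lower i) (spaceTurn S.lower i) := by
    intro i hi hin
    rw [hquad hlow i hi hin, mem_Icc, ← abs_le, habs]
    exact abs_quadTurn_le_spaceTurn _ _ _
  have hturn_up : ∀ i, 1 ≤ i → i + 2 ≤ S.n →
      turnAngle (fun i => φ (S.upper i)) i ∈
        Icc (-spaceTurn S.upper i) (spaceTurn S.upper i) := by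
    intro i hi hin
    rw [hquad hup i hi hin, mem_Icc, ← abs_le, habs, ← abs_neg, ← hcyl.quadTurn_upper hi hin]
    exact abs_quadTurn_le_spaceTurn _ _ _
  have hconc : ∀ c : ℝ, ∀ i j, 1 ≤ i → i ≤ j → j < S.n →
      (h (j + 1) + c) - (h j + c) ≤ (h (i + 1) + c) - (h i + c) := by
    intro c i j hi hij hj
    linarith [hcyl.slope_antitone hi hij hj, hcyl.step i, hcyl.step j]
  refine ⟨hcyl.injOn hφ, hlow.isConvexChain, hup.isConvexChain, ⟨σ, hσ, fun i hi hin => ?_⟩,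
    fun i hi hin => ⟨hturn_low i hi hin, hturn_up i hi hin⟩, ?_, ?_, ?_, hlow.isSimpleChain,
    hup.isSimpleChain, ?_, hcyl.disjoint_chainCurve hφ⟩
  · refine ⟨hquad hlow i hi hin, ?_⟩
    rw [hquad hup i hi hin, hcyl.quadTurn_upper hi hin]
    ring
  · -- The turn angles of the two chains agree, and they have the sign of `κ`.
    have heq : ∀ i, 1 ≤ i → i + 2 ≤ S.n →
        turnAngle (fun i => φ (S.upper i)) i = turnAngle (fun i => φ (S.lower i)) i :=
      fun i hi hin => (hquad hup i hi hin).trans (hquad hlow i hi hin).symm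
    rcases hlow.isConvexChain.2 with hsign | hsign
    · exact Or.inl fun i hi hin => ⟨hsign i hi hin, heq i hi hin ▸ hsign i hi hin⟩
    · exact Or.inr fun i hi hin => ⟨hsign i hi hin, heq i hi hin ▸ hsign i hi hin⟩
  · refine exists_isValidStraightening (by simpa using hconc 0) hcyl.lower ?_
      hturn_low
    intro i hi hin
    obtain ⟨h1, h2, -, -⟩ := hcyl.corners_mem hi hin
    exact hφ.isometric i hi hin _ h1 _ h2
  · refine exists_isValidStraightening (h := fun i => h i + b) (hconc b)
      hcyl.upper ?_ hturn_up
    intro i hi hin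
    obtain ⟨-, -, h1, h2⟩ := hcyl.corners_mem hi hin
    exact hφ.isometric i hi hin _ h1 _ h2
  · intro i j hi hin hj hjn
    exact line_parallel_of_sub_eq
      ((hcyl.ladder_const hφ hi hin).trans (hcyl.ladder_const hφ hj hjn).symm)
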